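/- \textbf{Theorem (Volume doubling).} Let $G=(V,q)$ be a finite graph, i.e. $V$ is a finite set and $q:V\times V\to[0,\infty)$ satisfies $q(x,x)=0$ for all $x\in V$, and suppose that $q(x,y)>0$ for at least one pair $x,y$. Suppose that $G$ is reversible with reversible measure $m:V\to(0,\infty)$, i.e. $q(x,y)m(x)=q(y,x)m(y)$ for all $x,y\in V$. Put \[ q_{\min}:=\min\{q(x,y): x,y\in V,\ q(x,y)>0\},\qquad D:=\max_{x\in V}\sum_{y\in V} q(x,y), \] $m(A):=\sum_{y\in A}m(y)$ for $A\subseteq V$, and $B_r(x):=\{y\in V: d(x,y)\le r\}$, where $d$ is the combinatorial graph distance with respect to the adjacency relation $x\sim y :\Leftrightarrow q(x,y)>0 \text{ or } q(y,x)>0$ (with $d(x,y)=\infty$ if $x$ and $y$ are not connected). For $f,g:V\to\mathbb R$ let $\Delta f(x):=\sum_{y}q(x,y)(f(y)-f(x))$, $\Gamma_0(f,g):=fg$ and \[ 2\Gamma_{k+1}(f,g):=\Delta\Gamma_k(f,g)-\Gamma_k(f,\Delta g)-\Gamma_k(\Delta f,g). \] Let $n\in(0,\infty)$ be a real number and suppose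 that $G$ satisfies the curvature dimension inequality $CD(0,n)$, i.e. $\Gamma_2(f,f)\ge\frac1n(\Delta f)^2$ pointwise on $V$ for all $f:V\to\mathbb R$. Then for every real $r\ge 4n^2D/q_{\min}$ and every $x\in V$, \[ \frac{m(B_{2r}(x))}{m(B_r(x))}\le\left(9n\sqrt{\frac{D}{q_{\min}}}\right)^{3n}. \] -/

import Mathlib

/-- A finite graph `(V, q)`: a jump rate function `q : V × V → [0, ∞)` vanishing on the diagonal.
No symmetry is required; finiteness of `V` is supplied by `[Fintype V]`. -/
structure RateGraph (V : Type*) where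
  /-- the jump rates -/
  q : V → V → ℝ
  q_nonneg : ∀ x y, 0 ≤ q x y
  q_self : ∀ x, q x x = 0

namespace RateGraph

variable {V : Type*}

/-- `m` is a reversible measure: `m : V → (0, ∞)` with `q(x,y) m(x) = q(y,x) m(y)`. -/
def IsReversibleMeasure (G : RateGraph V) (m : V → ℝ) : Prop :=
  (∀ x, 0 < m x) ∧ ∀ x y, G.q x y * m x = G.q y x * m y

/-- The adjacency relation: `x ∼ y` iff `q(x,y) > 0` or `q(y,x) > 0`. -/
def toSimpleGraph (G : RateGraph V) : SimpleGraph V where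
  Adj x y := 0 < G.q x y ∨ 0 < G.q y x
  symm := ⟨fun _ _ h => h.symm⟩
  loopless := ⟨fun x h => by simp [G.q_self x] at h⟩

/-- The minimum positive jump rate `q_min = min {q(x,y) : q(x,y) > 0}`. On a finite graph with at
least one positive rate the infimum of this finite nonempty set is its minimum. -/
noncomputable def qmin (G : RateGraph V) : ℝ :=
  sInf {c : ℝ | ∃ x y, 0 < G.q x y ∧ c = G.q x y}

/-- The ball `B_r(x) = {y : d(x,y) ≤ r}` for the combinatorial distance `d`. Since
`SimpleGraph.dist` is `0` between different components, where `d = ∞`, reachability is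
required explicitly. -/
def ball (G : RateGraph V) (x : V) (r : ℝ) : Set V :=
  {y | G.toSimpleGraph.Reachable x y ∧ (G.toSimpleGraph.dist x y : ℝ) ≤ r}

variable [Fintype V]

/-- The maximum vertex degree `D = max_x ∑_y q(x,y)`. -/
noncomputable def maxDegree (G : RateGraph V) : ℝ :=
  ⨆ x, ∑ y, G.q x y

/-- The Laplacian `Δ f(x) = ∑_y q(x,y) (f(y) - f(x))`. -/
def laplacian (G : RateGraph V) (f : V → ℝ) : V → ℝ :=
  fun x => ∑ y, G.q x y * (f y - f x)

/-- The iterated Bakry–Émery operators: `Γ₀(f,g) = f g` and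
`2 Γₖ₊₁(f,g) = Δ Γₖ(f,g) - Γₖ(f,Δ g) - Γₖ(Δ f,g)`. -/
noncomputable def Gam (G : RateGraph V) : ℕ → (V → ℝ) → (V → ℝ) → V → ℝ
  | 0, f, g => fun x => f x * g x
  | k + 1, f, g => fun x =>
      (G.laplacian (Gam G k f g) x - Gam G k f (G.laplacian g) x
        - Gam G k (G.laplacian f) g x) / 2

/-- The curvature dimension inequality `CD(K,n)` for finite dimension `n ∈ (0, ∞)`:
`Γ₂ f ≥ (1/n) (Δ f)² + K Γ f` pointwise, for all `f`. -/
def CD (G : RateGraph V) (K n : ℝ) : Prop :=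
  ∀ (f : V → ℝ) (x : V),
    1 / n * (G.laplacian f x) ^ 2 + K * G.Gam 1 f f x ≤ G.Gam 2 f f x

end RateGraph

/-- The measure `m(A) = ∑_{y ∈ A} m(y)` of a set of vertices. -/
noncomputable def vertexVolume {V : Type*} [Fintype V] (m : V → ℝ) (A : Set V) : ℝ :=
  ∑ y, A.indicator m y

/-! The flow `u' = Δu + Γ(u,u)` plays the role of the logarithm of a heat solution. Its
linearization is a jump equation with rates `q(x,y) (1 + u(y) - u(x))`, nonnegative as long as
`|u(y) - u(x)| ≤ 1` along edges. Under `CD(0,n)`, `Δu` is a supersolution and `Γ(u,u)` a subsolution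
of it, with surplus terms `±(2/n)(Δu)²`. The minimum principle then preserves the bound on `Γ(u,u)`
and yields `Δu ≥ -n/(2t)` (`IsFlowOn.li_yau`), together with a bound integrable at `t = 0`
(`IsFlowOn.sub_log_le`).

Start from `u₀ = -s d(x,·)`. At `x` the solution loses at most `2n log 2` up to a time `t₀`, and the
Harnack inequality (`harnack_dist`) spreads this lower bound over `B_ρ(x)`. Since `∑ m exp(3u/2)`
over the component of `x` does not increase (`IsFlowOn.sum_exp_le`), `m(B_ρ(x)) ≤ C(ρ) M` with `M =
∑ m exp(-3sd/2)` (`vertexVolume_ball_le`).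

For `s` proportional to `n √(D/q_min) / r`, `C(ρ)` is bounded by a power of `ρ/r`, while the weights
in `M` decay exponentially. Hence the part of `M` outside `B_r(x)` is absorbed and `M ≤ 2
m(B_r(x))`; taking `ρ = 2r` gives doubling. This uses `D ≥ 2 q_min`; otherwise components have at
most two vertices and both balls coincide. -/

namespace RateGraph

/-! ### Calculus of `Δ` and `Γ` -/

section Calculus

variable {V : Type*} [Fintype V] (G : RateGraph V)

/-- The carré du champ `Γ(f,g)(x) = ½ ∑_y q(x,y) (f(y) - f(x)) (g(y) - g(x))`. -/
noncomputable def gamma (f g : V → ℝ) (x : V) : ℝ :=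
  (∑ y, G.q x y * ((f y - f x) * (g y - g x))) / 2

lemma gamma_comm (f g : V → ℝ) (x : V) : G.gamma f g x = G.gamma g f x := by
  simp only [gamma, mul_comm (f _ - f x)]

lemma Gam_one (f g : V → ℝ) : G.Gam 1 f g = G.gamma f g := by
  funext x
  simp only [Gam, laplacian, gamma, Finset.mul_sum, Finset.sum_mul, ← Finset.sum_sub_distrib]
  congr 1
  exact Finset.sum_congr rfl fun y _ => by ring

lemma Gam_two_self (f : V → ℝ) (x : V) :
    G.Gam 2 f f x = G.laplacian (G.gamma f f) x / 2 - G.gamma f (G.laplacian f) x := by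
  change (G.laplacian (G.Gam 1 f f) x - G.Gam 1 f (G.laplacian f) x
    - G.Gam 1 (G.laplacian f) f x) / 2 = _
  rw [Gam_one, Gam_one, Gam_one, gamma_comm G (G.laplacian f) f]
  ring

lemma gamma_self_nonneg (f : V → ℝ) (x : V) : 0 ≤ G.gamma f f x :=
  div_nonneg (Finset.sum_nonneg fun y _ =>
    mul_nonneg (G.q_nonneg x y) (mul_self_nonneg _)) zero_le_two

variable {G} in
lemma CD.zero_le {n : ℝ} (h : G.CD 0 n) (f : V → ℝ) (x : V) :
    2 / n * (G.laplacian f x) ^ 2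
      ≤ G.laplacian (G.gamma f f) x - 2 * G.gamma f (G.laplacian f) x := by
  have := h f x
  rw [Gam_two_self] at this
  have e : 2 / n = 2 * (1 / n) := by ring
  rw [e]
  linarith

lemma laplacian_add (f g : V → ℝ) (x : V) :
    G.laplacian (fun y => f y + g y) x = G.laplacian f x + G.laplacian g x := by
  simp only [laplacian, ← Finset.sum_add_distrib]
  exact Finset.sum_congr rfl fun y _ => by ring

lemma gamma_add_right (f g h : V → ℝ) (x : V) :
    G.gamma f (fun y => g y + h y) x = G.gamma f g x + G.gamma f h x := by
  simp only [gamma, ← add_div, ← Finset.sum_add_distrib]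
  congr 1
  exact Finset.sum_congr rfl fun y _ => by ring

/-- The linearization of `Δu + Γ(u,u)` in direction `w`, written as a jump operator so that the
minimum principle applies. -/
lemma laplacian_add_two_gamma (u w : V → ℝ) (x : V) :
    G.laplacian w x + 2 * G.gamma u w x
      = ∑ y, G.q x y * (1 + (u y - u x)) * (w y - w x) := by
  simp only [laplacian, gamma, mul_div_cancel₀ _ (two_ne_zero' ℝ), ← Finset.sum_add_distrib]
  exact Finset.sum_congr rfl fun y _ => by ring

lemma laplacian_add_gamma (u : V → ℝ) (x : V) :
    G.laplacian u x + G.gamma u u x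
      = ∑ y, G.q x y * ((u y - u x) + (u y - u x) ^ 2 / 2) := by
  simp only [laplacian, gamma, Finset.sum_div, ← Finset.sum_add_distrib]
  exact Finset.sum_congr rfl fun y _ => by ring

end Calculus

/-! ### Bounds by `q_min` and `D`, and `n ≥ 1` -/

section Rates

variable {V : Type*} (G : RateGraph V)

lemma qmin_le {x y : V} (h : 0 < G.q x y) : G.qmin ≤ G.q x y :=
  csInf_le ⟨0, by rintro c ⟨x, y, hxy, rfl⟩; exact hxy.le⟩ ⟨x, y, h, rfl⟩

variable [Fintype V]

lemma exists_qmin_eq (hedge : ∃ x y, 0 < G.q x y) : ∃ x y, 0 < G.q x y ∧ G.qmin = G.q x y := by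
  have hfin : {c : ℝ | ∃ x y, 0 < G.q x y ∧ c = G.q x y}.Finite := by
    refine (Set.finite_range fun p : V × V => G.q p.1 p.2).subset ?_
    rintro c ⟨x, y, -, rfl⟩
    exact ⟨(x, y), rfl⟩
  obtain ⟨x, y, h⟩ := hedge
  have hne : {c : ℝ | ∃ x y, 0 < G.q x y ∧ c = G.q x y}.Nonempty := ⟨_, x, y, h, rfl⟩
  exact hne.csInf_mem hfin

lemma qmin_pos (hedge : ∃ x y, 0 < G.q x y) : 0 < G.qmin := by
  obtain ⟨x, y, h, e⟩ := G.exists_qmin_eq hedge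
  rwa [e]

lemma sum_q_le_maxDegree (x : V) : ∑ y, G.q x y ≤ G.maxDegree :=
  le_ciSup (f := fun x => ∑ y, G.q x y) (Set.finite_range _).bddAbove x

lemma q_le_maxDegree (x y : V) : G.q x y ≤ G.maxDegree :=
  (Finset.single_le_sum (f := fun y => G.q x y) (fun z _ => G.q_nonneg x z)
    (Finset.mem_univ y)).trans (G.sum_q_le_maxDegree x)

lemma qmin_le_maxDegree (hedge : ∃ x y, 0 < G.q x y) : G.qmin ≤ G.maxDegree := by
  obtain ⟨x, y, -, e⟩ := G.exists_qmin_eq hedge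
  exact e ▸ G.q_le_maxDegree x y

lemma exists_sum_q_eq_maxDegree [Nonempty V] : ∃ x, ∑ y, G.q x y = G.maxDegree :=
  exists_eq_ciSup_of_finite (f := fun x => ∑ y, G.q x y)

lemma gamma_self_le_of_abs_le {f : V → ℝ} {s : ℝ} {x : V}
    (h : ∀ y, 0 < G.q x y → |f y - f x| ≤ s) :
    G.gamma f f x ≤ G.maxDegree * s ^ 2 / 2 := by
  have : ∑ y, G.q x y * ((f y - f x) * (f y - f x)) ≤ ∑ y, G.q x y * s ^ 2 := by
    refine Finset.sum_le_sum fun y _ => ?_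
    rcases (G.q_nonneg x y).eq_or_lt with h0 | h0
    · simp [← h0]
    · refine mul_le_mul_of_nonneg_left ?_ h0.le
      have := sq_le_sq' (by linarith [abs_nonneg (f y - f x), h y h0]) (h y h0)
      rw [sq_abs] at this
      linarith [sq (f y - f x)]
  rw [← Finset.sum_mul] at this
  have h2 := mul_le_mul_of_nonneg_right (G.sum_q_le_maxDegree x) (sq_nonneg s)
  unfold gamma
  linarith

lemma qmin_mul_sq_le_gamma {f : V → ℝ} {x y : V} (h : 0 < G.q x y) :
    G.qmin * (f y - f x) ^ 2 ≤ 2 * G.gamma f f x := by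
  have h1 : G.q x y * ((f y - f x) * (f y - f x)) ≤ 2 * G.gamma f f x := by
    rw [gamma, mul_div_cancel₀ _ (two_ne_zero' ℝ)]
    exact Finset.single_le_sum (f := fun y => G.q x y * ((f y - f x) * (f y - f x)))
      (fun z _ => mul_nonneg (G.q_nonneg x z) (mul_self_nonneg _)) (Finset.mem_univ y)
  have h2 := mul_le_mul_of_nonneg_right (G.qmin_le h) (sq_nonneg (f y - f x))
  nlinarith

/-- The dimension in `CD(0,n)` is at least one on a graph with an edge. -/
lemma CD.one_le {G : RateGraph V} (hedge : ∃ x y, 0 < G.q x y) {n : ℝ} (hn : 0 < n)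
    (h : G.CD 0 n) : 1 ≤ n := by
  classical
  have : Nonempty V := ⟨hedge.choose⟩
  obtain ⟨x, hx⟩ := G.exists_sum_q_eq_maxDegree
  have hD : 0 < G.maxDegree := (G.qmin_pos hedge).trans_le (G.qmin_le_maxDegree hedge)
  set D := G.maxDegree
  -- At a vertex of maximal degree this test function has `Δf = -D`, and `CD(0,n)` gives `(2/n) D² ≤
  -- 2 D²`.
  let f : V → ℝ := Pi.single x 1
  have hfx : f x = 1 := Pi.single_eq_same _ _
  have hfy : ∀ y, y ≠ x → f y = 0 := fun y hy => Pi.single_eq_of_ne hy _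
  have hdiff : ∀ y, G.q x y * (f y - f x) = - G.q x y := fun y => by
    rcases eq_or_ne y x with rfl | hy
    · simp [G.q_self]
    · rw [hfy y hy, hfx]; ring
  have hL : G.laplacian f x = -D := by
    simp only [laplacian, hdiff, Finset.sum_neg_distrib, hx]
  have hLy : ∀ y, y ≠ x → G.laplacian f y = G.q y x := fun y hy => by
    simp only [laplacian, hfy y hy]
    rw [Finset.sum_eq_single x (fun z _ hz => by simp [hfy z hz]) (by simp), hfx]
    ring
  have hG : G.gamma f f x = D / 2 := by
    simp only [gamma, ← mul_assoc, hdiff]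
    congr 1
    rw [← hx]
    refine Finset.sum_congr rfl fun y _ => ?_
    have := hdiff y
    linarith
  have hGy : ∀ y, y ≠ x → G.gamma f f y = G.q y x / 2 := fun y hy => by
    simp only [gamma, hfy y hy]
    rw [Finset.sum_eq_single x (fun z _ hz => by simp [hfy z hz]) (by simp), hfx]
    ring
  have key := h.zero_le f x
  have e1 : G.laplacian (G.gamma f f) x - 2 * G.gamma f (G.laplacian f) x
      = ∑ y, G.q x y * (3 / 2 * G.q y x + D / 2) := by
    rw [gamma, mul_div_cancel₀ _ (two_ne_zero' ℝ), laplacian, ← Finset.sum_sub_distrib]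
    refine Finset.sum_congr rfl fun y _ => ?_
    rcases eq_or_ne y x with rfl | hy
    · simp [G.q_self]
    · rw [hGy y hy, hG, hLy y hy, hL, hfy y hy, hfx]; ring
  have e2 : ∑ y, G.q x y * (3 / 2 * G.q y x + D / 2) ≤ ∑ y, G.q x y * (2 * D) :=
    Finset.sum_le_sum fun y _ => mul_le_mul_of_nonneg_left
      (by linarith [G.q_le_maxDegree y x]) (G.q_nonneg x y)
  rw [← Finset.sum_mul, hx] at e2
  rw [e1, hL] at key
  have : 2 / n * (-D) ^ 2 ≤ D * (2 * D) := key.trans e2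
  rw [div_mul_eq_mul_div, div_le_iff₀ hn] at this
  have hD2 : 0 < D ^ 2 := by positivity
  nlinarith

end Rates

/-! ### Reversible measures -/

section Reversible

variable {V : Type*} {G : RateGraph V} {m : V → ℝ}

lemma IsReversibleMeasure.q_pos_symm (hm : G.IsReversibleMeasure m) {x y : V}
    (h : 0 < G.q x y) : 0 < G.q y x := by
  have := hm.2 x y
  have h1 : 0 < G.q y x * m y := this ▸ mul_pos h (hm.1 x)
  exact pos_of_mul_pos_left h1 (hm.1 y).le

lemma IsReversibleMeasure.adj_iff (hm : G.IsReversibleMeasure m) {x y : V} :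
    G.toSimpleGraph.Adj x y ↔ 0 < G.q x y :=
  ⟨fun h => h.elim id hm.q_pos_symm, Or.inl⟩

variable [Fintype V]

/-- The Laplacian has integral zero against any symmetrizing weight. -/
lemma sum_mul_laplacian_eq_zero (hm : ∀ x y, G.q x y * m x = G.q y x * m y) (f : V → ℝ) :
    ∑ x, m x * G.laplacian f x = 0 := by
  have e1 : ∑ x, m x * G.laplacian f x
      = ∑ x, ∑ y, G.q x y * m x * f y - ∑ x, ∑ y, G.q x y * m x * f x := by
    simp only [laplacian, Finset.mul_sum, ← Finset.sum_sub_distrib]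
    exact Finset.sum_congr rfl fun x _ => Finset.sum_congr rfl fun y _ => by ring
  have e2 : ∑ x, ∑ y, G.q x y * m x * f y = ∑ x, ∑ y, G.q x y * m x * f x := by
    rw [Finset.sum_comm]
    exact Finset.sum_congr rfl fun x _ => Finset.sum_congr rfl fun y _ => by rw [hm y x]
  rw [e1, e2, sub_self]

end Reversible

end RateGraph

/-! ### Minimum principle and existence for the truncated equation -/

/-- Minimum principle for supersolutions of a jump equation with nonnegative,
time dependent rates. -/
lemma nonneg_of_jump_supersolution {V : Type*} [Fintype V] {a b : ℝ}
    {w w' : ℝ → V → ℝ} {k : ℝ → V → V → ℝ}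
    (hd : ∀ t ∈ Set.Icc a b, ∀ x, HasDerivAt (fun t => w t x) (w' t x) t)
    (hk : ∀ t ∈ Set.Icc a b, ∀ x y, 0 ≤ k t x y)
    (hw : ∀ t ∈ Set.Icc a b, ∀ x, ∑ y, k t x y * (w t y - w t x) ≤ w' t x)
    (h0 : ∀ x, 0 ≤ w a x) {t : ℝ} (ht : t ∈ Set.Icc a b) (x : V) : 0 ≤ w t x := by
  have hab : a ≤ b := ht.1.trans ht.2
  have : Nonempty V := ⟨x⟩
  -- The tilt makes the inequality strict: at a space-time minimum after time `a` the jump sum is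
  -- nonnegative, so the tilted derivative is at least `ε`, whereas difference quotients from the
  -- left are nonpositive.
  have key : ∀ ε > 0, 0 ≤ w t x + ε * (t - a) := by
    intro ε hε
    have hc : ∀ y, ∃ τ ∈ Set.Icc a b, ∀ σ ∈ Set.Icc a b,
        w τ y + ε * (τ - a) ≤ w σ y + ε * (σ - a) := fun y =>
      isCompact_Icc.exists_isMinOn (Set.nonempty_Icc.2 hab)
        (f := fun τ => w τ y + ε * (τ - a)) (ContinuousOn.add
          (fun τ hτ => (hd τ hτ y).continuousAt.continuousWithinAt) (by fun_prop))
    choose τ hτ hmin using hc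
    obtain ⟨z, hz⟩ := Finite.exists_min fun y => w (τ y) y + ε * (τ y - a)
    have hglob : ∀ σ ∈ Set.Icc a b, ∀ y, w (τ z) z + ε * (τ z - a) ≤ w σ y + ε * (σ - a) :=
      fun σ hσ y => (hz y).trans (hmin y σ hσ)
    rcases (hτ z).1.eq_or_lt with h | h
    · refine le_trans ?_ (hglob t ht x)
      rw [← h]; simpa using h0 z
    · exfalso
      have hsum : 0 ≤ ∑ y, k (τ z) z y * (w (τ z) y - w (τ z) z) :=
        Finset.sum_nonneg fun y _ => mul_nonneg (hk _ (hτ z) z y)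
          (by linarith [hglob (τ z) (hτ z) y])
      have hpos : 0 < w' (τ z) z + ε := by linarith [hw _ (hτ z) z]
      have hder : HasDerivAt (fun σ => w σ z + ε * (σ - a)) (w' (τ z) z + ε) (τ z) := by
        have := (hd _ (hτ z) z).fun_add (((hasDerivAt_id' (τ z)).sub_const a).const_mul ε)
        rwa [mul_one] at this
      have hle : w' (τ z) z + ε ≤ 0 := by
        refine le_of_tendsto ((hasDerivWithinAt_iff_tendsto_slope' (by simp)).1
          (hder.hasDerivWithinAt (s := Set.Iio (τ z)))) ?_
        filter_upwards [Ioo_mem_nhdsLT h] with σ hσ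
        rw [slope_def_field]
        exact div_nonpos_of_nonneg_of_nonpos
          (by linarith [hglob σ ⟨hσ.1.le, hσ.2.le.trans (hτ z).2⟩ z]) (by linarith [hσ.2])
      linarith
  by_contra! hneg
  have h1 := key (-(w t x) / (2 * (t - a + 1))) (div_pos (by linarith) (by linarith [ht.1]))
  have h2 : -(w t x) / (2 * (t - a + 1)) * (t - a) ≤ -(w t x) / 2 := by
    rw [div_mul_eq_mul_div, div_le_div_iff₀ (by linarith [ht.1]) two_pos]
    nlinarith [ht.1]
  linarith

/-- Global existence for an autonomous equation with bounded Lipschitz right-hand side. -/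
lemma exists_hasDerivAt_of_lipschitz_of_bounded {E : Type*} [NormedAddCommGroup E]
    [NormedSpace ℝ E] [CompleteSpace E] {F : E → E} {K L : NNReal} (hK : LipschitzWith K F)
    (hL : ∀ u, ‖F u‖ ≤ L) (u₀ : E) {T : ℝ} (hT : 0 ≤ T) :
    ∃ u : ℝ → E, u 0 = u₀ ∧ ∀ t ∈ Set.Icc 0 T, HasDerivAt u (F (u t)) t := by
  -- The interval exceeds `[0,T]` on both sides, so that derivatives at `0` and `T` are two-sided.
  have hPL : IsPicardLindelof (fun _ => F)
      (⟨0, by constructor <;> linarith⟩ : Set.Icc (-1) (T + 1)) u₀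
      (L * ⟨T + 1, by linarith⟩) 0 L K := by
    refine .of_time_independent (fun x _ => hL x) hK.lipschitzOnWith ?_
    have h1 : max (T + 1 - 0) (0 - -1) = T + 1 := by
      rw [max_eq_left] <;> linarith
    change (L : ℝ) * max (T + 1 - 0) (0 - -1) ≤ L * (T + 1) - 0
    rw [h1, sub_zero]
  obtain ⟨u, hu0, hu⟩ := hPL.exists_eq_forall_mem_Icc_hasDerivWithinAt₀
  exact ⟨u, hu0, fun t ht => (hu t ⟨by linarith [ht.1], by linarith [ht.2]⟩).hasDerivAt
    (Icc_mem_nhds (by linarith [ht.1]) (by linarith [ht.2]))⟩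

/-- The truncation of `δ ↦ δ + δ² / 2` to arguments in `[-1,1]`. -/
noncomputable def truncatedQuadratic (δ : ℝ) : ℝ :=
  max (-1) (min 1 δ) + (max (-1) (min 1 δ)) ^ 2 / 2

lemma truncatedQuadratic_of_abs_le {δ : ℝ} (h : |δ| ≤ 1) :
    truncatedQuadratic δ = δ + δ ^ 2 / 2 := by
  rw [truncatedQuadratic, min_eq_right (abs_le.1 h).2, max_eq_right (abs_le.1 h).1]

lemma abs_truncatedQuadratic_le (δ : ℝ) : |truncatedQuadratic δ| ≤ 2 := by
  have h1 : -1 ≤ max (-1) (min 1 δ) := le_max_left _ _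
  have h2 : max (-1) (min 1 δ) ≤ 1 := max_le (by norm_num) (min_le_left _ _)
  rw [truncatedQuadratic, abs_le]
  constructor <;> nlinarith

lemma abs_truncatedQuadratic_sub_le (δ ε : ℝ) :
    |truncatedQuadratic δ - truncatedQuadratic ε| ≤ 2 * |δ - ε| := by
  have h1 : ∀ δ : ℝ, -1 ≤ max (-1) (min 1 δ) := fun δ => le_max_left _ _
  have h2 : ∀ δ : ℝ, max (-1) (min 1 δ) ≤ 1 := fun δ => max_le (by norm_num) (min_le_left _ _)
  have h3 : |max (-1) (min 1 δ) - max (-1) (min 1 ε)| ≤ |δ - ε| := by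
    refine (abs_max_sub_max_le_max _ _ _ _).trans ?_
    rw [sub_self, abs_zero, max_eq_right (abs_nonneg _)]
    refine (abs_min_sub_min_le_max _ _ _ _).trans ?_
    rw [sub_self, abs_zero, max_eq_right (abs_nonneg _)]
  simp only [truncatedQuadratic]
  have hδ := h1 δ
  have hε := h1 ε
  have hδ2 := h2 δ
  have hε2 := h2 ε
  set a := max (-1) (min 1 δ)
  set b := max (-1) (min 1 ε)
  rw [show a + a ^ 2 / 2 - (b + b ^ 2 / 2) = (1 + (a + b) / 2) * (a - b) by ring, abs_mul]
  refine mul_le_mul ?_ h3 (abs_nonneg _) zero_le_two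
  rw [abs_le]
  constructor <;> linarith

namespace RateGraph

variable {V : Type*} [Fintype V] (G : RateGraph V)

/-- Global existence for the truncation of the nonlinear heat equation `u' = Δu + Γ(u,u)`. -/
lemma exists_truncated_flow (u₀ : V → ℝ) {T : ℝ} (hT : 0 ≤ T) :
    ∃ u : ℝ → V → ℝ, u 0 = u₀ ∧ ∀ t ∈ Set.Icc 0 T, ∀ x, HasDerivAt (fun t => u t x)
      (∑ y, G.q x y * truncatedQuadratic (u t y - u t x)) t := by
  have hS : 0 ≤ ∑ x, ∑ y, G.q x y :=
    Finset.sum_nonneg fun z _ => Finset.sum_nonneg fun _ _ => G.q_nonneg z _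
  set S := ∑ x, ∑ y, G.q x y
  have hrow : ∀ x, ∑ y, G.q x y ≤ S := fun x =>
    Finset.single_le_sum (f := fun x => ∑ y, G.q x y)
        (fun z _ => Finset.sum_nonneg fun _ _ => G.q_nonneg z _) (Finset.mem_univ x)
  let F : (V → ℝ) → V → ℝ := fun u x => ∑ y, G.q x y * truncatedQuadratic (u y - u x)
  have hK : LipschitzWith (4 * S).toNNReal F := by
    refine LipschitzWith.of_dist_le_mul fun u v => ?_
    rw [Real.coe_toNNReal _ (by positivity), dist_pi_le_iff (by positivity)]
    intro x
    rw [Real.dist_eq]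
    simp only [F, ← Finset.sum_sub_distrib, ← mul_sub]
    calc |∑ y, G.q x y * (truncatedQuadratic (u y - u x) - truncatedQuadratic (v y - v x))|
        ≤ ∑ y, G.q x y * (4 * dist u v) := by
          refine (Finset.abs_sum_le_sum_abs _ _).trans (Finset.sum_le_sum fun y _ => ?_)
          rw [abs_mul, abs_of_nonneg (G.q_nonneg x y)]
          refine mul_le_mul_of_nonneg_left ?_ (G.q_nonneg x y)
          refine (abs_truncatedQuadratic_sub_le _ _).trans ?_
          have h1 := dist_le_pi_dist u v x
          have h2 := dist_le_pi_dist u v y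
          rw [Real.dist_eq] at h1 h2
          rw [show u y - u x - (v y - v x) = (u y - v y) - (u x - v x) by ring]
          linarith [abs_sub (u y - v y) (u x - v x)]
      _ ≤ S * (4 * dist u v) := by
          rw [← Finset.sum_mul]
          exact mul_le_mul_of_nonneg_right (hrow x) (by positivity)
      _ = 4 * S * dist u v := by ring
  have hL : ∀ u, ‖F u‖ ≤ (2 * S).toNNReal := by
    intro u
    rw [Real.coe_toNNReal _ (by positivity)]
    rw [pi_norm_le_iff_of_nonneg (by positivity)]
    intro x
    calc ‖F u x‖ ≤ ∑ y, G.q x y * 2 := by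
          refine (Finset.abs_sum_le_sum_abs _ _).trans (Finset.sum_le_sum fun y _ => ?_)
          rw [abs_mul, abs_of_nonneg (G.q_nonneg x y)]
          exact mul_le_mul_of_nonneg_left (abs_truncatedQuadratic_le _) (G.q_nonneg x y)
      _ ≤ 2 * S := by
          rw [← Finset.sum_mul]
          linarith [hrow x]
  obtain ⟨u, hu0, hu⟩ := exists_hasDerivAt_of_lipschitz_of_bounded hK hL u₀ hT
  exact ⟨u, hu0, fun t ht x => hasDerivAt_pi.1 (hu t ht) x⟩

end RateGraph

/-! ### The nonlinear heat flow and the Li–Yau inequality -/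

namespace RateGraph

variable {V : Type*} {G : RateGraph V}

/-- Rates of the linearized flow are nonnegative when the discrete gradient is at most one. -/
lemma drift_rate_nonneg {u : V → ℝ} {x y : V} (h : 0 < G.q x y → |u y - u x| ≤ 1) :
    0 ≤ G.q x y * (1 + (u y - u x)) := by
  rcases (G.q_nonneg x y).eq_or_lt with h0 | h0
  · simp [← h0]
  · exact mul_nonneg h0.le (by linarith [(abs_le.1 (h h0)).1])

variable [Fintype V]

variable (G) in
/-- `u` solves the nonlinear heat equation `u' = Δu + Γ(u,u)` on the set `S` of times. -/
def IsFlowOn (u : ℝ → V → ℝ) (S : Set ℝ) : Prop :=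
  ∀ t ∈ S, ∀ x, HasDerivAt (fun t => u t x)
    (G.laplacian (u t) x + G.gamma (u t) (u t) x) t

lemma IsFlowOn.mono {u : ℝ → V → ℝ} {S S' : Set ℝ} (h : G.IsFlowOn u S) (hS : S' ⊆ S) :
    G.IsFlowOn u S' :=
  fun t ht => h t (hS ht)

lemma hasDerivAt_laplacian {u : ℝ → V → ℝ} {u' : V → ℝ} {t : ℝ}
    (h : ∀ x, HasDerivAt (fun t => u t x) (u' x) t) (x : V) :
    HasDerivAt (fun t => G.laplacian (u t) x) (G.laplacian u' x) t :=
  HasDerivAt.fun_sum fun y _ => ((h y).fun_sub (h x)).const_mul _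

lemma hasDerivAt_gamma {u : ℝ → V → ℝ} {u' : V → ℝ} {t : ℝ}
    (h : ∀ x, HasDerivAt (fun t => u t x) (u' x) t) (x : V) :
    HasDerivAt (fun t => G.gamma (u t) (u t) x) (2 * G.gamma (u t) u' x) t := by
  have h1 : HasDerivAt (fun t => ∑ y, G.q x y * ((u t y - u t x) * (u t y - u t x)))
      (∑ y, G.q x y * ((u' y - u' x) * (u t y - u t x) + (u t y - u t x) * (u' y - u' x))) t :=
    HasDerivAt.fun_sum fun y _ =>
      (((h y).fun_sub (h x)).fun_mul ((h y).fun_sub (h x))).const_mul _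
  have h2 := h1.div_const 2
  refine h2.congr_deriv ?_
  rw [gamma, mul_div_assoc', Finset.mul_sum]
  congr 1
  exact Finset.sum_congr rfl fun y _ => by ring

/-- The drift operator of the linearized flow. -/
noncomputable def drift (G : RateGraph V) (u w : V → ℝ) (x : V) : ℝ :=
  ∑ y, G.q x y * (1 + (u y - u x)) * (w y - w x)

lemma drift_affine (u v g : V → ℝ) (a b : ℝ) (x : V) :
    G.drift u (fun y => a * v y - g y + b) x = a * G.drift u v x - G.drift u g x := by
  simp only [drift, Finset.mul_sum, ← Finset.sum_sub_distrib]
  exact Finset.sum_congr rfl fun y _ => by ring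

/-- In `(Δu)' = Δ(Δu) + ΔΓ(u,u)`, `CD(0,n)` bounds the last term below by `2Γ(u,Δu) + (2/n)(Δu)²`,
and `2Γ(u,Δu)` completes `Δ(Δu)` to the drift. -/
lemma IsFlowOn.hasDerivAt_laplacian_flow {u : ℝ → V → ℝ} {S : Set ℝ} (h : G.IsFlowOn u S)
    {n : ℝ} (hCD : G.CD 0 n) {t : ℝ} (ht : t ∈ S) (x : V) :
    ∃ v', HasDerivAt (fun t => G.laplacian (u t) x) v' t ∧
      G.drift (u t) (G.laplacian (u t)) x + 2 / n * G.laplacian (u t) x ^ 2 ≤ v' := by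
  refine ⟨_, hasDerivAt_laplacian (h t ht) x, ?_⟩
  rw [laplacian_add G, drift, ← laplacian_add_two_gamma]
  linarith [hCD.zero_le (u t) x]

/-- Now `CD(0,n)` serves as an upper bound for `2Γ(u,Δu)`, so the square appears with the opposite
sign. -/
lemma IsFlowOn.hasDerivAt_gamma_flow {u : ℝ → V → ℝ} {S : Set ℝ} (h : G.IsFlowOn u S)
    {n : ℝ} (hCD : G.CD 0 n) {t : ℝ} (ht : t ∈ S) (x : V) :
    ∃ g', HasDerivAt (fun t => G.gamma (u t) (u t) x) g' t ∧
      g' ≤ G.drift (u t) (G.gamma (u t) (u t)) x - 2 / n * G.laplacian (u t) x ^ 2 := by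
  refine ⟨_, hasDerivAt_gamma (h t ht) x, ?_⟩
  rw [gamma_add_right G, drift, ← laplacian_add_two_gamma]
  linarith [hCD.zero_le (u t) x]

/-- The maximum of `Γ(u,u)` does not increase along the flow. -/
lemma IsFlowOn.gamma_le {u : ℝ → V → ℝ} {a b : ℝ} (h : G.IsFlowOn u (Set.Icc a b))
    {n : ℝ} (hn : 0 < n) (hCD : G.CD 0 n)
    (hgrad : ∀ t ∈ Set.Icc a b, ∀ x y, 0 < G.q x y → |u t y - u t x| ≤ 1)
    {g₀ : ℝ} (h0 : ∀ x, G.gamma (u a) (u a) x ≤ g₀) {t : ℝ} (ht : t ∈ Set.Icc a b) (x : V) :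
    G.gamma (u t) (u t) x ≤ g₀ := by
  choose! g' hg' hg'le using fun t ht x => h.hasDerivAt_gamma_flow hCD (t := t) ht x
  have := nonneg_of_jump_supersolution (w := fun t x => g₀ - G.gamma (u t) (u t) x)
    (w' := fun t x => -g' t x) (k := fun t x y => G.q x y * (1 + (u t y - u t x)))
    (fun t ht x => (hg' t ht x).const_sub g₀)
    (fun t ht x y => drift_rate_nonneg (hgrad t ht x y)) ?_ (fun x => sub_nonneg.2 (h0 x)) ht x
  · linarith
  intro t ht x
  have h1 := hg'le t ht x
  have h2 : 0 ≤ 2 / n * G.laplacian (u t) x ^ 2 := by positivity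
  have h3 : ∑ y, G.q x y * (1 + (u t y - u t x)) *
      (g₀ - G.gamma (u t) (u t) y - (g₀ - G.gamma (u t) (u t) x))
      = - G.drift (u t) (G.gamma (u t) (u t)) x := by
    rw [drift, ← Finset.sum_neg_distrib]
    exact Finset.sum_congr rfl fun y _ => by ring
  rw [h3]
  linarith

/-- A lower bound for `Δu` interpolating between the initial gradient bound and the
Li–Yau inequality. -/
lemma IsFlowOn.laplacian_lower_bound {u : ℝ → V → ℝ} {T : ℝ} (h : G.IsFlowOn u (Set.Icc 0 T))
    {n : ℝ} (hn : 0 < n) (hCD : G.CD 0 n)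
    (hgrad : ∀ t ∈ Set.Icc 0 T, ∀ x y, 0 < G.q x y → |u t y - u t x| ≤ 1)
    {g₀ : ℝ} (h0 : ∀ x, G.gamma (u 0) (u 0) x ≤ g₀) {t : ℝ} (ht : t ∈ Set.Icc 0 T) (x : V)
    {c : ℝ} (hc : 0 ≤ c) :
    -(g₀ + n / 2 * c ^ 2 * t) ≤ ((1 + c * t) ^ 2 - 1) * G.laplacian (u t) x := by
  choose! g' hg' hg'le using fun t ht x => h.hasDerivAt_gamma_flow hCD (t := t) ht x
  choose! v' hv' hv'le using fun t ht x => h.hasDerivAt_laplacian_flow hCD (t := t) ht x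
  have hcoef : ∀ t, HasDerivAt (fun t : ℝ => (1 + c * t) ^ 2 - 1) (2 * c * (1 + c * t)) t := by
    intro t
    have h1 := ((((hasDerivAt_id' t).const_mul c).const_add 1).fun_pow 2).sub_const 1
    refine h1.congr_deriv ?_
    push_cast
    ring
  have hlin : ∀ t, HasDerivAt (fun t : ℝ => g₀ + n / 2 * c ^ 2 * t) (n / 2 * c ^ 2) t := by
    intro t
    have h1 := ((hasDerivAt_id' t).const_mul (n / 2 * c ^ 2)).const_add g₀
    rwa [mul_one] at h1
  -- The coefficient `(1 + ct)² - 1` vanishes at `t = 0`, and its derivative is the cross term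
  -- needed to complete the square with both `(2/n)(Δu)²` contributions and `(n/2)c²`.
  have := nonneg_of_jump_supersolution
    (w := fun t x => ((1 + c * t) ^ 2 - 1) * G.laplacian (u t) x - G.gamma (u t) (u t) x
      + (g₀ + n / 2 * c ^ 2 * t))
    (w' := fun t x => (2 * c * (1 + c * t) * G.laplacian (u t) x
      + ((1 + c * t) ^ 2 - 1) * v' t x) - g' t x + n / 2 * c ^ 2)
    (k := fun t x y => G.q x y * (1 + (u t y - u t x)))
    (fun t ht x => (((hcoef t).fun_mul (hv' t ht x)).fun_sub (hg' t ht x)).fun_add (hlin t))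
    (fun t ht x y => drift_rate_nonneg (hgrad t ht x y)) ?_ ?_ ht x
  · linarith [G.gamma_self_nonneg (u t) x]
  · intro t ht x
    have ht0 : 0 ≤ t := ht.1
    have e := drift_affine (G := G) (u t) (G.laplacian (u t)) (G.gamma (u t) (u t))
      ((1 + c * t) ^ 2 - 1) (g₀ + n / 2 * c ^ 2 * t) x
    rw [drift] at e
    rw [e]
    have hcoef0 : 0 ≤ (1 + c * t) ^ 2 - 1 := by nlinarith [mul_nonneg hc ht0]
    have h1 := mul_le_mul_of_nonneg_left (hv'le t ht x) hcoef0
    have h2 := hg'le t ht x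
    set v := G.laplacian (u t) x
    have h3 : 0 ≤ 2 / n * ((1 + c * t) * v + n * c / 2) ^ 2 := by positivity
    have h4 : 2 / n * ((1 + c * t) * v + n * c / 2) ^ 2
        = 2 / n * ((1 + c * t) ^ 2 * v ^ 2) + 2 * c * (1 + c * t) * v + n / 2 * c ^ 2 := by
      field_simp
      ring
    nlinarith
  · intro x
    simpa using h0 x

/-- The Li–Yau inequality. -/
lemma IsFlowOn.li_yau {u : ℝ → V → ℝ} {T : ℝ} (h : G.IsFlowOn u (Set.Icc 0 T))
    {n : ℝ} (hn : 0 < n) (hCD : G.CD 0 n)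
    (hgrad : ∀ t ∈ Set.Icc 0 T, ∀ x y, 0 < G.q x y → |u t y - u t x| ≤ 1)
    {g₀ : ℝ} (h0 : ∀ x, G.gamma (u 0) (u 0) x ≤ g₀) {t : ℝ} (ht : t ∈ Set.Icc 0 T)
    (ht0 : 0 < t) (x : V) :
    -(n / (2 * t)) ≤ G.laplacian (u t) x := by
  by_contra! hlt
  set v := G.laplacian (u t) x with hv
  have hδ : 0 < -(t * v + n / 2) := by
    have := mul_lt_mul_of_pos_left hlt ht0
    have e : t * -(n / (2 * t)) = -(n / 2) := by field_simp
    linarith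
  have hv0 : v < 0 := hlt.trans (neg_neg_of_pos (by positivity))
  have hg0 : 0 ≤ g₀ := (G.gamma_self_nonneg (u 0) x).trans (h0 x)
  set δ := -(t * v + n / 2) with hδdef
  -- Divided by `c² t`, the lower bound tends to `-n/2 ≤ tΔu` as `c → ∞`. This `c` already suffices
  -- for a contradiction: `c² δ t > g₀`, where `δ` is the supposed deficit.
  set c := g₀ / (δ * t) + 1 with hc
  have hc0 : 1 ≤ c := by
    have : 0 ≤ g₀ / (δ * t) := by positivity
    linarith
  have h1 := h.laplacian_lower_bound hn hCD hgrad h0 ht x (c := c) (by linarith)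
  rw [← hv] at h1
  have h2 : g₀ < c * (δ * t) := by
    rw [hc, add_mul, div_mul_cancel₀ _ (by positivity)]
    nlinarith
  have h3 : c * (δ * t) ≤ c ^ 2 * (δ * t) :=
    mul_le_mul_of_nonneg_right (by nlinarith) (by positivity)
  have h4 : 2 * c * t * v ≤ 0 := mul_nonpos_of_nonneg_of_nonpos (by positivity) hv0.le
  have h5 : ((1 + c * t) ^ 2 - 1) * v + n / 2 * c ^ 2 * t = 2 * c * t * v - c ^ 2 * (δ * t) := by
    rw [hδdef]; ring
  linarith

/-- Existence of the flow with a gradient bound preserved, for initial data with small gradient. -/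
lemma exists_flow (hedge : ∃ x y, 0 < G.q x y) {n : ℝ} (hn : 0 < n) (hCD : G.CD 0 n)
    {u₀ : V → ℝ} {g₀ : ℝ} (h0 : ∀ x, G.gamma u₀ u₀ x ≤ g₀) (hg₀ : 2 * g₀ < G.qmin)
    {T : ℝ} (hT : 0 ≤ T) :
    ∃ u : ℝ → V → ℝ, u 0 = u₀ ∧ G.IsFlowOn u (Set.Icc 0 T) ∧
      ∀ t ∈ Set.Icc 0 T, ∀ x, G.gamma (u t) (u t) x ≤ g₀ := by
  have hq := G.qmin_pos hedge
  obtain ⟨u, hu0, hu⟩ := G.exists_truncated_flow u₀ hT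
  have hflow : ∀ t ∈ Set.Icc 0 T, (∀ x y, 0 < G.q x y → |u t y - u t x| ≤ 1) →
      ∀ x, HasDerivAt (fun t => u t x) (G.laplacian (u t) x + G.gamma (u t) (u t) x) t := by
    intro t ht hg x
    refine (hu t ht x).congr_deriv ?_
    rw [laplacian_add_gamma]
    refine Finset.sum_congr rfl fun y _ => ?_
    rcases (G.q_nonneg x y).eq_or_lt with hxy | hxy
    · simp [← hxy]
    · rw [truncatedQuadratic_of_abs_le (hg x y hxy)]
  have hlt : ∀ f : V → ℝ, (∀ x, G.gamma f f x ≤ g₀) → ∀ x y, 0 < G.q x y → |f y - f x| < 1 := by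
    intro f hf x y hxy
    rw [← sq_lt_one_iff_abs_lt_one]
    have := G.qmin_mul_sq_le_gamma (f := f) hxy
    by_contra! hge
    nlinarith [hf x]
  have hcont : ∀ t ∈ Set.Icc 0 T, ∀ x, ContinuousAt (fun t => u t x) t :=
    fun t ht x => (hu t ht x).continuousAt
  -- Continuity induction: `Γ ≤ g₀` and `2g₀ < q_min` force edge gradients strictly below one. They
  -- stay so for a short time, on which the truncation is inactive and `IsFlowOn.gamma_le` renews
  -- the bound.
  have hmem : Set.Icc 0 T ⊆ {t | ∀ x, G.gamma (u t) (u t) x ≤ g₀} := by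
    refine IsClosed.Icc_subset_of_forall_mem_nhdsWithin ?_ (by simpa [hu0] using h0) ?_
    · have : {t | ∀ x, G.gamma (u t) (u t) x ≤ g₀} ∩ Set.Icc 0 T
          = Set.Icc 0 T ∩ (fun t x => G.gamma (u t) (u t) x) ⁻¹' Set.Iic (fun _ => g₀) := by
        rw [Set.inter_comm]
        rfl
      rw [this]
      refine ContinuousOn.preimage_isClosed_of_isClosed (fun t ht => ?_) isClosed_Icc isClosed_Iic
      exact (continuousAt_pi.2 fun x =>
        (hasDerivAt_gamma (hu t ht) x).continuousAt).continuousWithinAt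
    · rintro t ⟨htg, ht0, htT⟩
      have ht : t ∈ Set.Icc 0 T := ⟨ht0, htT.le⟩
      have hev : ∀ᶠ τ in nhds t, ∀ x y, 0 < G.q x y → |u τ y - u τ x| < 1 := by
        refine Filter.eventually_all.2 fun x => Filter.eventually_all.2 fun y => ?_
        by_cases hxy : 0 < G.q x y
        · have hc : ContinuousAt (fun τ => |u τ y - u τ x|) t :=
            ((hcont t ht y).sub (hcont t ht x)).abs
          filter_upwards [hc.eventually_lt_const (hlt _ htg x y hxy)] with τ hτ _ using hτ
        · exact Filter.Eventually.of_forall fun τ h => absurd h hxy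
      obtain ⟨ε, hε, hball⟩ := Metric.eventually_nhds_iff.1 hev
      filter_upwards [Ioo_mem_nhdsGT (lt_min htT (show t < t + ε by linarith))] with τ hτ
      have hτT : τ < T := hτ.2.trans_le (min_le_left _ _)
      have hτε : τ < t + ε := hτ.2.trans_le (min_le_right _ _)
      have hgrad : ∀ σ ∈ Set.Icc t τ, ∀ x y, 0 < G.q x y → |u σ y - u σ x| ≤ 1 :=
        fun σ hσ x y hxy => (hball (by
          rw [Real.dist_eq, abs_lt]; constructor <;> linarith [hσ.1, hσ.2]) x y hxy).le
      have hfl : G.IsFlowOn u (Set.Icc t τ) := fun σ hσ =>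
        hflow σ ⟨ht0.trans hσ.1, hσ.2.trans hτT.le⟩ (hgrad σ hσ)
      exact fun x => hfl.gamma_le hn hCD hgrad htg ⟨hτ.1.le, le_rfl⟩ x
  exact ⟨u, hu0, fun t ht => hflow t ht fun x y hxy => (hlt _ (hmem ht) x y hxy).le, hmem⟩

end RateGraph

/-! ### Two real-variable tools -/

/-- At `x = 3δ/2` the left side is `1 + (3/2)(δ + δ²/2)`, matching the flow; the range `x ≥ -6/5`
allows gradients up to `4/5`. -/
lemma one_add_add_sq_div_three_le_exp {x : ℝ} (hx : -(6 / 5) ≤ x) :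
    1 + x + x ^ 2 / 3 ≤ Real.exp x := by
  rcases le_total 0 x with h | h
  · nlinarith [Real.quadratic_le_exp_of_nonneg h]
  -- `Real.exp_bound` needs an argument of modulus at most one, hence the Taylor bound at `x / 2`,
  -- squared afterwards.
  · have h1 := Real.exp_bound (x := x / 2) (by rw [abs_le]; constructor <;> linarith)
      (n := 4) (by norm_num)
    have h2 := (abs_le.1 h1).1
    rw [abs_of_nonpos (by linarith)] at h2
    norm_num [Finset.sum_range_succ, Nat.factorial] at h2
    have h3 : Real.exp x = Real.exp (x / 2) ^ 2 := by
      rw [← Real.exp_nat_mul]; ring_nf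
    obtain ⟨z, rfl⟩ : ∃ z, x = -(2 * z) := ⟨-x / 2, by ring⟩
    have hz : 0 ≤ z := by linarith
    have hz1 : z ≤ 3 / 5 := by linarith
    have h4 : 1 - z + z ^ 2 / 2 - z ^ 3 / 6 - 5 * z ^ 4 / 96 ≤ Real.exp (-(2 * z) / 2) := by
      nlinarith
    have h5 : 0 ≤ 1 - z + z ^ 2 / 2 - z ^ 3 / 6 - 5 * z ^ 4 / 96 := by
      nlinarith [pow_le_pow_left₀ hz hz1 2, pow_le_pow_left₀ hz hz1 3, pow_le_pow_left₀ hz hz1 4]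
    rw [h3]
    refine le_trans ?_ (pow_le_pow_left₀ h5 h4 2)
    have e : (1 - z + z ^ 2 / 2 - z ^ 3 / 6 - 5 * z ^ 4 / 96) ^ 2
      - (1 + -(2 * z) + (-(2 * z)) ^ 2 / 3) = z ^ 2 * (2 / 3 - 4 / 3 * z + 23 / 48 * z ^ 2
       + z ^ 3 * (-1/16) + z^4 * (-7/288) + z ^ 5 * (5 / 288) + z ^ 6 * (25 / 9216)) := by ring
    have h6 : 0 ≤ 2 / 3 - 4 / 3 * z + 23 / 48 * z ^ 2
       + z ^ 3 * (-1/16) + z^4 * (-7/288) + z ^ 5 * (5 / 288) + z ^ 6 * (25 / 9216) := by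
      have := pow_le_pow_left₀ hz hz1 3
      have := pow_le_pow_left₀ hz hz1 4
      nlinarith [pow_nonneg hz 5, pow_nonneg hz 6, sq_nonneg (z - 3 / 5)]
    nlinarith [mul_nonneg (sq_nonneg z) h6]

lemma monotoneOn_Icc_of_hasDerivAt_nonneg {f f' : ℝ → ℝ} {a b : ℝ}
    (hc : ContinuousOn f (Set.Icc a b)) (hd : ∀ t ∈ Set.Ioo a b, HasDerivAt f (f' t) t)
    (h0 : ∀ t ∈ Set.Ioo a b, 0 ≤ f' t) : MonotoneOn f (Set.Icc a b) := by
  refine monotoneOn_of_deriv_nonneg (convex_Icc a b) hc ?_ ?_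
  · rw [interior_Icc]
    exact fun t ht => (hd t ht).differentiableAt.differentiableWithinAt
  · rw [interior_Icc]
    exact fun t ht => (hd t ht).deriv.symm ▸ h0 t ht

/-! ### Harnack inequalities and the exponential integral -/

namespace RateGraph

variable {V : Type*} [Fintype V] {G : RateGraph V}

section Harnack

variable {h h' : ℝ → V → ℝ} {a b : ℝ}

lemma monotoneOn_of_gamma_le_deriv
    (hd : ∀ t ∈ Set.Icc a b, ∀ x, HasDerivAt (fun t => h t x) (h' t x) t)
    (hh : ∀ t ∈ Set.Icc a b, ∀ x, G.gamma (h t) (h t) x ≤ h' t x) (x : V) :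
    MonotoneOn (fun t => h t x) (Set.Icc a b) :=
  monotoneOn_Icc_of_hasDerivAt_nonneg
    (fun t ht => (hd t ht x).continuousAt.continuousWithinAt)
    (fun t ht => hd t (Set.Ioo_subset_Icc_self ht) x)
    (fun t ht => (G.gamma_self_nonneg _ _).trans (hh t (Set.Ioo_subset_Icc_self ht) x))

/-- Harnack inequality across one edge. -/
lemma harnack_edge (hedge : ∃ x y, 0 < G.q x y)
    (hd : ∀ t ∈ Set.Icc a b, ∀ x, HasDerivAt (fun t => h t x) (h' t x) t)
    (hh : ∀ t ∈ Set.Icc a b, ∀ x, G.gamma (h t) (h t) x ≤ h' t x)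
    {x y : V} (hxy : 0 < G.q y x) (hab : a < b) :
    h a x - 2 / (G.qmin * (b - a)) ≤ h b y := by
  have hq := G.qmin_pos hedge
  have hba : 0 < b - a := sub_pos.2 hab
  by_contra! hlt
  have hbm : b ∈ Set.Icc a b := ⟨hab.le, le_rfl⟩
  have ham : a ∈ Set.Icc a b := ⟨le_rfl, hab.le⟩
  have hpos : ∀ t ∈ Set.Icc a b, 2 / (G.qmin * (b - a)) < h a x - h t y := fun t ht => by
    have : h t y ≤ h b y := monotoneOn_of_gamma_le_deriv hd hh y ht hbm ht.2
    linarith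
  have hη : 0 < 2 / (G.qmin * (b - a)) := by positivity
  -- For `φ(t) = h a x - h t y`, monotonicity of `h` at `x` gives `φ' ≤ -(q_min/2) φ²`. So `1/φ`
  -- grows at rate at least `q_min/2`, which makes `φ(b)` too small for the assumed failure.
  have hder : ∀ t ∈ Set.Icc a b, HasDerivAt (fun t => (h a x - h t y)⁻¹ - G.qmin / 2 * t)
      (-(-h' t y) / (h a x - h t y) ^ 2 - G.qmin / 2) t := fun t ht => by
    have h1 := ((hd t ht y).const_sub (h a x)).fun_inv (hη.trans (hpos t ht)).ne'
    have h2 := h1.fun_sub ((hasDerivAt_id' t).const_mul (G.qmin / 2))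
    rwa [mul_one] at h2
  have hmono := monotoneOn_Icc_of_hasDerivAt_nonneg
    (fun t ht => (hder t ht).continuousAt.continuousWithinAt)
    (fun t ht => hder t (Set.Ioo_subset_Icc_self ht)) (fun t ht => by
      have ht := Set.Ioo_subset_Icc_self ht
      have hφ := hη.trans (hpos t ht)
      rw [neg_neg, sub_nonneg, le_div_iff₀ (by positivity)]
      have h1 : h a x ≤ h t x := monotoneOn_of_gamma_le_deriv hd hh x ham ht ht.1
      have h2 := G.qmin_mul_sq_le_gamma (f := h t) hxy
      have h3 := hh t ht y
      have h4 : (h a x - h t y) ^ 2 ≤ (h t x - h t y) ^ 2 :=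
        pow_le_pow_left₀ hφ.le (by linarith) 2
      have h5 := mul_le_mul_of_nonneg_left h4 hq.le
      linarith) ham hbm hab.le
  simp only at hmono
  have h1 : (h a x - h b y)⁻¹ < (2 / (G.qmin * (b - a)))⁻¹ :=
    inv_strictAnti₀ hη (hpos b hbm)
  have h2 : 0 < (h a x - h a y)⁻¹ := inv_pos.2 (hη.trans (hpos a ham))
  rw [inv_div] at h1
  have h3 : G.qmin * (b - a) / 2 = G.qmin / 2 * b - G.qmin / 2 * a := by ring
  linarith

/-- Harnack inequality along a walk, with time `τ` spent on each edge. -/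
lemma harnack_walk (hedge : ∃ x y, 0 < G.q x y)
    (hd : ∀ t ∈ Set.Icc a b, ∀ x, HasDerivAt (fun t => h t x) (h' t x) t)
    (hh : ∀ t ∈ Set.Icc a b, ∀ x, G.gamma (h t) (h t) x ≤ h' t x)
    (hadj : ∀ x y, G.toSimpleGraph.Adj x y → 0 < G.q y x)
    {τ : ℝ} (hτ : 0 < τ) {x y : V} (p : G.toSimpleGraph.Walk x y) {t : ℝ} (hat : a ≤ t)
    (ht : t + p.length * τ ≤ b) :
    h t x - p.length * (2 / (G.qmin * τ)) ≤ h (t + p.length * τ) y := by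
  induction p generalizing t with
  | nil => simp
  | @cons x z y hxz p ih =>
    rw [SimpleGraph.Walk.length_cons, Nat.cast_add, Nat.cast_one] at *
    have hl : 0 ≤ (p.length : ℝ) * τ := by positivity
    have hsub : Set.Icc t (t + τ) ⊆ Set.Icc a b := Set.Icc_subset_Icc hat (by linarith)
    have h1 := harnack_edge hedge (fun s hs => hd s (hsub hs)) (fun s hs => hh s (hsub hs))
      (hadj x z hxz) (show t < t + τ by linarith)
    rw [add_sub_cancel_left] at h1
    have h2 := ih (t := t + τ) (by linarith) (by linarith)
    rw [show t + (p.length + 1) * τ = t + τ + p.length * τ by ring]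
    linarith

/-- Harnack inequality for points at distance at most `ρ`. -/
lemma harnack_dist (hedge : ∃ x y, 0 < G.q x y)
    (hd : ∀ t ∈ Set.Icc a b, ∀ x, HasDerivAt (fun t => h t x) (h' t x) t)
    (hh : ∀ t ∈ Set.Icc a b, ∀ x, G.gamma (h t) (h t) x ≤ h' t x)
    (hadj : ∀ x y, G.toSimpleGraph.Adj x y → 0 < G.q y x) (hab : a < b)
    {ρ : ℝ} (hρ : 0 < ρ) {x y : V} (hy : y ∈ G.ball x ρ) :
    h a x - 2 * ρ ^ 2 / (G.qmin * (b - a)) ≤ h b y := by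
  have hq := G.qmin_pos hedge
  have hba : 0 < b - a := sub_pos.2 hab
  obtain ⟨hreach, hdist⟩ := hy
  obtain ⟨p, hp⟩ := hreach.exists_walk_length_eq_dist
  rw [← hp] at hdist
  have hτ : 0 < (b - a) / ρ := by positivity
  have hle : (p.length : ℝ) * ((b - a) / ρ) ≤ b - a :=
    calc (p.length : ℝ) * ((b - a) / ρ) ≤ ρ * ((b - a) / ρ) :=
          mul_le_mul_of_nonneg_right hdist hτ.le
      _ = b - a := by field_simp
  have h0 : 0 ≤ (p.length : ℝ) * ((b - a) / ρ) := by positivity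
  have h1 := harnack_walk hedge hd hh hadj hτ p le_rfl (by linarith)
  have h2 : h (a + p.length * ((b - a) / ρ)) y ≤ h b y :=
    monotoneOn_of_gamma_le_deriv hd hh y ⟨by linarith, by linarith⟩ ⟨hab.le, le_rfl⟩
      (by linarith)
  have h3 : (p.length : ℝ) * (2 / (G.qmin * ((b - a) / ρ))) ≤ 2 * ρ ^ 2 / (G.qmin * (b - a)) :=
    calc (p.length : ℝ) * (2 / (G.qmin * ((b - a) / ρ)))
        ≤ ρ * (2 / (G.qmin * ((b - a) / ρ))) :=
          mul_le_mul_of_nonneg_right hdist (by positivity)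
      _ = 2 * ρ ^ 2 / (G.qmin * (b - a)) := by field_simp
  linarith

end Harnack

/-- Along the flow, the solution at a point decreases at most logarithmically. -/
lemma IsFlowOn.sub_log_le {u : ℝ → V → ℝ} {T : ℝ} (h : G.IsFlowOn u (Set.Icc 0 T))
    {n : ℝ} (hn : 0 < n) (hCD : G.CD 0 n)
    (hgrad : ∀ t ∈ Set.Icc 0 T, ∀ x y, 0 < G.q x y → |u t y - u t x| ≤ 1)
    {γ : ℝ} (hγ : 0 < γ) (h0 : ∀ x, G.gamma (u 0) (u 0) x ≤ n * γ ^ 2 / 2) (hT : 0 ≤ T) (x : V) :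
    u 0 x ≤ u T x + 2 * n * Real.log (1 + γ * √T / 2) := by
  have hmono : MonotoneOn (fun t => u t x + 2 * n * Real.log (1 + γ * √t / 2)) (Set.Icc 0 T) := by
    refine monotoneOn_Icc_of_hasDerivAt_nonneg
      (f' := fun t => G.laplacian (u t) x + G.gamma (u t) (u t) x
        + 2 * n * (γ * (1 / (2 * √t)) / 2 / (1 + γ * √t / 2))) ?_ ?_ ?_
    · refine ContinuousOn.add (fun t ht => (h t ht x).continuousAt.continuousWithinAt) ?_
      refine continuousOn_const.mul (ContinuousOn.log (by fun_prop) fun t _ => ?_)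
      have : 0 ≤ γ * √t / 2 := by positivity
      linarith
    · intro t ht
      have h1 : (1 + γ * √t / 2) ≠ 0 := by
        have : 0 ≤ γ * √t / 2 := by positivity
        linarith
      exact (h t (Set.Ioo_subset_Icc_self ht) x).fun_add
        ((((((hasDerivAt_id' t).sqrt ht.1.ne').const_mul γ).div_const 2).const_add 1 |>.log
          h1).const_mul _)
    · intro t ht
      have ht0 : 0 < t := ht.1
      have hs : 0 < √t := Real.sqrt_pos.2 ht0
      have hst : √t * √t = t := Real.mul_self_sqrt ht0.le
      -- This `c`, depending on `t`, makes both terms `g₀` and `(n/2)c²t` equal to `nγ²/2`; the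
      -- resulting lower bound for `Δu` is minus the derivative of the logarithm.
      have h1 := h.laplacian_lower_bound hn hCD hgrad h0 (Set.Ioo_subset_Icc_self ht) x
        (c := γ / √t) (by positivity)
      have e1 : γ / √t * t = γ * √t := by
        rw [div_mul_eq_mul_div, div_eq_iff hs.ne', mul_assoc, hst]
      have e2 : (γ / √t) ^ 2 * t = γ ^ 2 := by
        rw [div_pow, Real.sq_sqrt ht0.le]; field_simp
      rw [e1, mul_assoc (n / 2), e2] at h1
      have e3 : 2 * n * (γ * (1 / (2 * √t)) / 2 / (1 + γ * √t / 2))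
          = n * γ / (√t * (2 + γ * √t)) := by
        field_simp
      rw [e3]
      have h2 : 0 ≤ G.laplacian (u t) x + n * γ / (√t * (2 + γ * √t)) := by
        by_contra! hneg
        have hp : 0 < (1 + γ * √t) ^ 2 - 1 := by
          have : 0 < γ * √t := by positivity
          nlinarith
        have h3 := mul_neg_of_pos_of_neg hp hneg
        have e4 : ((1 + γ * √t) ^ 2 - 1) * (n * γ / (√t * (2 + γ * √t))) = n * γ ^ 2 := by
          field_simp
          ring
        rw [mul_add, e4] at h3
        linarith
      linarith [G.gamma_self_nonneg (u t) x]
  simpa using hmono ⟨le_rfl, hT⟩ ⟨hT, le_rfl⟩ hT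

/-- The weighted integral of `exp (3u/2)` does not increase along the flow. -/
lemma IsFlowOn.sum_exp_le {u : ℝ → V → ℝ} {T : ℝ} (h : G.IsFlowOn u (Set.Icc 0 T))
    (hgrad : ∀ t ∈ Set.Icc 0 T, ∀ x y, 0 < G.q x y → |u t y - u t x| ≤ 4 / 5)
    {m : V → ℝ} (hm0 : ∀ x, 0 ≤ m x) (hm : ∀ x y, G.q x y * m x = G.q y x * m y) (hT : 0 ≤ T) :
    ∑ x, m x * Real.exp (3 / 2 * u T x) ≤ ∑ x, m x * Real.exp (3 / 2 * u 0 x) := by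
  have hder : ∀ t ∈ Set.Icc 0 T, HasDerivAt (fun t => - ∑ x, m x * Real.exp (3 / 2 * u t x))
      (-∑ x, m x * (Real.exp (3 / 2 * u t x) *
        (3 / 2 * (G.laplacian (u t) x + G.gamma (u t) (u t) x)))) t := fun t ht =>
    (HasDerivAt.fun_sum fun x _ => (((h t ht x).const_mul (3 / 2)).exp).const_mul (m x)).fun_neg
  have hmono := monotoneOn_Icc_of_hasDerivAt_nonneg
    (fun t ht => (hder t ht).continuousAt.continuousWithinAt)
    (fun t ht => hder t (Set.Ioo_subset_Icc_self ht)) (fun t ht => by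
      have ht := Set.Ioo_subset_Icc_self ht
      -- Replacing zero by the integral of `Δ exp(3u/2)` reduces the claim to a comparison edge by
      -- edge.
      rw [neg_nonneg, ← sum_mul_laplacian_eq_zero hm fun x => Real.exp (3 / 2 * u t x)]
      refine Finset.sum_le_sum fun x _ => mul_le_mul_of_nonneg_left ?_ (hm0 x)
      rw [laplacian_add_gamma, laplacian, Finset.mul_sum, Finset.mul_sum]
      refine Finset.sum_le_sum fun y _ => ?_
      rcases (G.q_nonneg x y).eq_or_lt with hxy | hxy
      · simp [← hxy]
      · have h1 := one_add_add_sq_div_three_le_exp (x := 3 / 2 * (u t y - u t x))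
          (by linarith [(abs_le.1 (hgrad t ht x y hxy)).1])
        have h2 : Real.exp (3 / 2 * u t y)
            = Real.exp (3 / 2 * u t x) * Real.exp (3 / 2 * (u t y - u t x)) := by
          rw [← Real.exp_add]; ring_nf
        rw [h2]
        have h3 : 0 ≤ G.q x y * Real.exp (3 / 2 * u t x) :=
          mul_nonneg hxy.le (Real.exp_pos _).le
        have h4 := mul_le_mul_of_nonneg_left h1 h3
        linarith) ⟨le_rfl, hT⟩ ⟨hT, le_rfl⟩ hT
  exact neg_le_neg_iff.1 hmono

end RateGraph

/-! ### Layer decomposition of exponential weights -/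

lemma hasSum_layer {w : ℝ} (hw0 : 0 ≤ w) (hw1 : w < 1) (c : ℝ) (d : ℕ) :
    HasSum (fun k : ℕ => (1 - w) * w ^ k * if (d : ℝ) ≤ k then c else 0) (c * w ^ d) := by
  have h1 : HasSum (fun k : ℕ => (1 - w) * w ^ (k + d) * if (d : ℝ) ≤ (k + d : ℕ) then c else 0)
      (c * w ^ d) := by
    have h2 := (hasSum_geometric_of_lt_one hw0 hw1).mul_left ((1 - w) * w ^ d * c)
    have e : (1 - w) * w ^ d * c * (1 - w)⁻¹ = c * w ^ d := by
      field_simp [(sub_pos.2 hw1).ne']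
    rw [e] at h2
    refine h2.congr_fun fun k => ?_
    rw [if_pos (by exact_mod_cast Nat.le_add_left d k), pow_add]
    ring
  have h2 := (hasSum_nat_add_iff (f := fun k : ℕ =>
    (1 - w) * w ^ k * if (d : ℝ) ≤ k then c else 0) d).1 h1
  rwa [Finset.sum_eq_zero, add_zero] at h2
  intro i hi
  rw [if_neg (by exact_mod_cast (Finset.mem_range.1 hi).not_ge), mul_zero]

/-- If the masses of large sublevel sets of `d` are controlled, then the integral of `exp (-a d)`
is dominated by the mass of the sublevel set at height `r`. -/
lemma sum_exp_neg_le_of_layers {V : Type*} [Fintype V] {m : V → ℝ} (hm : ∀ y, 0 ≤ m y)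
    (d : V → ℕ) {a r E : ℝ} (ha : 0 < a) (hr : 0 ≤ r) (hE : 0 ≤ E)
    (hlayer : ∀ k : ℕ, r < k → Real.exp (-(a * k)) * (∑ y, if (d y : ℝ) ≤ k then m y else 0)
      ≤ E * Real.exp (-(3 / 4 * a * (k - r)))) :
    ∑ y, m y * Real.exp (-(a * d y))
      ≤ (∑ y, if (d y : ℝ) ≤ r then m y else 0) + 4 / 3 * E := by
  set w := Real.exp (-a) with hw
  have hw0 : 0 < w := Real.exp_pos _
  have hw1 : w < 1 := by rw [Real.exp_lt_one_iff]; linarith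
  have hwk : ∀ k : ℕ, Real.exp (-(a * k)) = w ^ k := fun k => by
    rw [hw, ← Real.exp_nat_mul]; ring_nf
  have hsum : HasSum (fun k : ℕ => (1 - w) * (w ^ k * ∑ y, if (d y : ℝ) ≤ k then m y else 0))
      (∑ y, m y * Real.exp (-(a * d y))) := by
    have h1 := hasSum_sum (s := Finset.univ) fun y (_ : y ∈ Finset.univ) =>
      hasSum_layer hw0.le hw1 (m y) (d y)
    simp only [hwk]
    refine h1.congr_fun fun k => ?_
    rw [← mul_assoc, Finset.mul_sum]
  -- The tail decays by `v³` per layer and `w = v⁴`; the constant `4/3` bounds `(1 - v⁴)/(1 - v³)`.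
  set v := Real.exp (-(a / 4)) with hv
  have hv0 : 0 < v := Real.exp_pos _
  have hv1 : v < 1 := by rw [Real.exp_lt_one_iff]; linarith
  have hwv : w = v ^ 4 := by rw [hw, hv, ← Real.exp_nat_mul]; congr 1; push_cast; ring
  have hv3 : v ^ 3 < 1 := pow_lt_one₀ hv0.le hv1 (by norm_num)
  set K := ⌊r⌋₊ + 1 with hK
  have hrK : r < K := by rw [hK]; exact_mod_cast Nat.lt_floor_add_one r
  have htail := (hasSum_nat_add_iff' K).2 hsum
  have hgeo := (hasSum_geometric_of_lt_one (pow_nonneg hv0.le 3) hv3).mul_left ((1 - w) * E)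
  have hle := hasSum_le (fun k : ℕ => ?_) htail hgeo
  · have hhead : ∑ i ∈ Finset.range K, (1 - w) * (w ^ i * ∑ y, if (d y : ℝ) ≤ i then m y else 0)
        ≤ ∑ y, if (d y : ℝ) ≤ r then m y else 0 := by
      set A := ∑ y, if (d y : ℝ) ≤ r then m y else 0 with hA
      have hA0 : 0 ≤ A := Finset.sum_nonneg fun y _ => by split_ifs <;> simp [hm y]
      calc ∑ i ∈ Finset.range K, (1 - w) * (w ^ i * ∑ y, if (d y : ℝ) ≤ i then m y else 0)
          ≤ ∑ i ∈ Finset.range K, (1 - w) * (w ^ i * A) := by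
            refine Finset.sum_le_sum fun i hi => ?_
            refine mul_le_mul_of_nonneg_left (mul_le_mul_of_nonneg_left ?_ (by positivity))
              (by linarith)
            have hir : (i : ℝ) ≤ r := by
              have : i ≤ ⌊r⌋₊ := Nat.lt_succ_iff.1 (Finset.mem_range.1 hi)
              exact (Nat.le_floor_iff hr).1 this
            refine Finset.sum_le_sum fun y _ => ?_
            by_cases h1 : (d y : ℝ) ≤ i
            · rw [if_pos h1, if_pos (h1.trans hir)]
            · rw [if_neg h1]; split_ifs <;> simp [hm y]
        _ = (1 - w ^ K) * A := by
            rw [← Finset.mul_sum, ← Finset.sum_mul, ← mul_assoc, mul_neg_geom_sum]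
        _ ≤ A := by
            have : 0 ≤ w ^ K := by positivity
            nlinarith
    have hfrac : (1 - w) * E * (1 - v ^ 3)⁻¹ ≤ 4 / 3 * E := by
      rw [← div_eq_mul_inv, div_le_iff₀ (by linarith), hwv]
      have : 0 ≤ (1 - v) ^ 2 * (1 + 2 * v + 3 * v ^ 2) := by positivity
      have h2 : 3 * (1 - v ^ 4) ≤ 4 * (1 - v ^ 3) := by nlinarith
      nlinarith
    linarith
  · have h1 := hlayer (k + K : ℕ) (by push_cast; linarith [(Nat.cast_nonneg k : (0:ℝ) ≤ k)])
    rw [hwk] at h1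
    have h2 : Real.exp (-(3 / 4 * a * ((k + K : ℕ) - r))) ≤ (v ^ 3) ^ k := by
      rw [hv, ← Real.exp_nat_mul, ← Real.exp_nat_mul, Real.exp_le_exp]
      push_cast
      nlinarith
    rw [mul_assoc (1 - w) E]
    exact mul_le_mul_of_nonneg_left (h1.trans (mul_le_mul_of_nonneg_left h2 hE)) (by linarith)

/-! ### Volume bounds from the flow -/

namespace RateGraph

variable {V : Type*} {G : RateGraph V} {m : V → ℝ}

/-- The restriction of `m` to the connected component of `x`. -/
noncomputable def componentMeasure (G : RateGraph V) (m : V → ℝ) (x : V) : V → ℝ :=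
  {y | G.toSimpleGraph.Reachable x y}.indicator m

lemma componentMeasure_nonneg (hm : G.IsReversibleMeasure m) (x y : V) :
    0 ≤ G.componentMeasure m x y :=
  Set.indicator_nonneg (fun z _ => (hm.1 z).le) y

/-- Rates between components vanish. The restriction is needed because `SimpleGraph.dist` is `0` on
other components, which would otherwise get full weight. -/
lemma componentMeasure_symm (hm : G.IsReversibleMeasure m) (x y z : V) :
    G.q y z * G.componentMeasure m x y = G.q z y * G.componentMeasure m x z := by
  rcases (G.q_nonneg y z).eq_or_lt with h | h
  · have h' : G.q z y = 0 := by
      by_contra hne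
      exact (hm.q_pos_symm ((G.q_nonneg z y).lt_of_ne' hne)).ne h
    rw [← h, h', zero_mul, zero_mul]
  · have hadj : G.toSimpleGraph.Adj y z := Or.inl h
    by_cases hy : G.toSimpleGraph.Reachable x y
    · have hz : G.toSimpleGraph.Reachable x z := hy.trans hadj.reachable
      simp only [componentMeasure, Set.indicator, Set.mem_ofPred_eq, hy, hz, if_true]
      exact hm.2 y z
    · have hz : ¬ G.toSimpleGraph.Reachable x z := fun h => hy (h.trans hadj.symm.reachable)
      simp only [componentMeasure, Set.indicator, Set.mem_ofPred_eq, hy, hz, if_false, mul_zero]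

lemma abs_dist_sub_dist_le_one {x y z : V} (h : G.toSimpleGraph.Adj y z) :
    |(G.toSimpleGraph.dist x z : ℝ) - G.toSimpleGraph.dist x y| ≤ 1 := by
  have h1 : G.toSimpleGraph.dist x z ≤ G.toSimpleGraph.dist x y + 1 ∧
      G.toSimpleGraph.dist x y ≤ G.toSimpleGraph.dist x z + 1 := by
    rcases h.diff_dist_adj (u := x) with h | h | h <;> omega
  have h2 : (G.toSimpleGraph.dist x z : ℝ) ≤ G.toSimpleGraph.dist x y + 1 := by
    exact_mod_cast h1.1
  have h3 : (G.toSimpleGraph.dist x y : ℝ) ≤ G.toSimpleGraph.dist x z + 1 := by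
    exact_mod_cast h1.2
  rw [abs_le]
  constructor <;> linarith

variable [Fintype V]

lemma vertexVolume_ball_eq (x : V) (ρ : ℝ) :
    vertexVolume m (G.ball x ρ)
      = ∑ y, if (G.toSimpleGraph.dist x y : ℝ) ≤ ρ then G.componentMeasure m x y else 0 := by
  refine Finset.sum_congr rfl fun y _ => ?_
  by_cases h1 : G.toSimpleGraph.Reachable x y <;>
  by_cases h2 : (G.toSimpleGraph.dist x y : ℝ) ≤ ρ <;>
  simp [componentMeasure, ball, Set.indicator, h1, h2]

lemma vertexVolume_ball_pos (hm : G.IsReversibleMeasure m) (x : V) {ρ : ℝ} (hρ : 0 ≤ ρ) :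
    0 < vertexVolume m (G.ball x ρ) := by
  refine Finset.sum_pos' (fun y _ => Set.indicator_nonneg (fun z _ => (hm.1 z).le) y)
    ⟨x, Finset.mem_univ x, ?_⟩
  rw [Set.indicator_of_mem]
  · exact hm.1 x
  · exact ⟨SimpleGraph.Reachable.refl x, by simpa using hρ⟩

/-- The volume of a ball is bounded by an exponentially weighted volume. -/
lemma vertexVolume_ball_le (hedge : ∃ x y, 0 < G.q x y) (hm : G.IsReversibleMeasure m)
    {n : ℝ} (hn : 0 < n) (hCD : G.CD 0 n) {s : ℝ} (hs : 0 < s)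
    (hsD : G.maxDegree * s ^ 2 ≤ 16 / 25 * G.qmin) (x : V) {ρ : ℝ} (hρ : 0 < ρ) :
    vertexVolume m (G.ball x ρ)
      ≤ (16 * Real.exp 1 * (1 + ρ ^ 2 * (G.maxDegree * s ^ 2) / (G.qmin * n ^ 2))) ^ (3 / 4 * n)
        * ∑ y, G.componentMeasure m x y *
          Real.exp (-(3 / 2 * s * G.toSimpleGraph.dist x y)) := by
  have hq := G.qmin_pos hedge
  have hD : 0 < G.maxDegree := hq.trans_le (G.qmin_le_maxDegree hedge)
  set D := G.maxDegree
  set q := G.qmin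
  let u₀ : V → ℝ := fun y => -(s * G.toSimpleGraph.dist x y)
  have hΓ₀ : ∀ y, G.gamma u₀ u₀ y ≤ D * s ^ 2 / 2 := fun y =>
    G.gamma_self_le_of_abs_le fun z hz => by
      have h1 := abs_dist_sub_dist_le_one (G := G) (x := x) (y := y) (z := z) (Or.inl hz)
      rw [show u₀ z - u₀ y = -(s * ((G.toSimpleGraph.dist x z : ℝ) - G.toSimpleGraph.dist x y)) by
        simp only [u₀]; ring, abs_neg, abs_mul, abs_of_pos hs]
      nlinarith
  -- This gives `γ√t₀ = 2`, hence a loss of `2n log 2` at `x`; the extra time in `T` makes the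
  -- Harnack cost exactly `n/2`. Together they produce the factor `16e`.
  set t₀ := 4 * n / (D * s ^ 2) with ht₀
  have ht₀pos : 0 < t₀ := by positivity
  set T := t₀ + 4 * ρ ^ 2 / (q * n) with hT
  have hδ : 0 < 4 * ρ ^ 2 / (q * n) := by positivity
  have htT : t₀ < T := by linarith
  obtain ⟨u, hu0, hflow, hΓ⟩ := exists_flow hedge hn hCD hΓ₀ (by linarith)
    (ht₀pos.trans htT).le
  have hgrad : ∀ t ∈ Set.Icc 0 T, ∀ y z, 0 < G.q y z → |u t z - u t y| ≤ 4 / 5 := by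
    intro t ht y z hyz
    have h1 := G.qmin_mul_sq_le_gamma (f := u t) hyz
    have h2 := hΓ t ht y
    refine abs_le_of_sq_le_sq ?_ (by norm_num)
    have h3 : q * (u t z - u t y) ^ 2 ≤ q * (4 / 5) ^ 2 := by linarith
    exact le_of_mul_le_mul_left h3 hq
  have hgrad1 : ∀ t ∈ Set.Icc 0 T, ∀ y z, 0 < G.q y z → |u t z - u t y| ≤ 1 :=
    fun t ht y z h => (hgrad t ht y z h).trans (by norm_num)
  have hx0 : -(2 * n * Real.log 2) ≤ u t₀ x := by
    set γ := √(D * s ^ 2 / n) with hγ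
    have hγpos : 0 < γ := Real.sqrt_pos.2 (by positivity)
    have hγ2 : γ ^ 2 = D * s ^ 2 / n := Real.sq_sqrt (by positivity)
    have hsub : Set.Icc 0 t₀ ⊆ Set.Icc 0 T := Set.Icc_subset_Icc_right htT.le
    have h1 := (hflow.mono hsub).sub_log_le hn hCD (fun t ht => hgrad1 t (hsub ht)) hγpos
      (fun y => by
        rw [hγ2, mul_div_cancel₀ _ hn.ne', hu0]
        exact hΓ₀ y) ht₀pos.le x
    have h2 : γ * √t₀ = 2 := by
      rw [hγ, ← Real.sqrt_mul (by positivity), ht₀,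
        show D * s ^ 2 / n * (4 * n / (D * s ^ 2)) = 2 ^ 2 by field_simp; norm_num]
      exact Real.sqrt_sq zero_le_two
    have h3 : u 0 x = 0 := by simp [hu0, u₀]
    rw [h2, h3] at h1
    norm_num at h1
    linarith
  have hlog : ∀ t, t ≠ 0 → HasDerivAt (fun t => n / 2 * Real.log t) (n / (2 * t)) t := fun t ht =>
    ((Real.hasDerivAt_log ht).const_mul (n / 2)).congr_deriv (by field_simp)
  have hIcc : Set.Icc t₀ T ⊆ Set.Icc 0 T := Set.Icc_subset_Icc_left ht₀pos.le
  have hlower : ∀ y ∈ G.ball x ρ,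
      -(n / 2 * Real.log (16 * Real.exp 1 * (T / t₀))) ≤ u T y := by
    intro y hy
    have h1 := harnack_dist (G := G) (h := fun t y => u t y + n / 2 * Real.log t) hedge
      (fun t ht z => (hflow t (hIcc ht) z).fun_add (hlog t (ht₀pos.trans_le ht.1).ne'))
      (fun t ht z => by
        have h2 := hflow.li_yau hn hCD hgrad1 (fun z => (hΓ 0 ⟨le_rfl, (ht₀pos.trans htT).le⟩ z))
          (hIcc ht) (ht₀pos.trans_le ht.1) z
        have h3 : G.gamma (fun y => u t y + n / 2 * Real.log t)
            (fun y => u t y + n / 2 * Real.log t) z = G.gamma (u t) (u t) z := by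
          simp [gamma]
        rw [h3]
        linarith)
      (fun y z h => h.elim hm.q_pos_symm id) htT hρ hy
    have h2 : 2 * ρ ^ 2 / (G.qmin * (T - t₀)) = n / 2 := by
      rw [hT, add_sub_cancel_left]
      change 2 * ρ ^ 2 / (q * _) = _
      field_simp
      norm_num
    rw [h2] at h1
    rw [Real.log_mul (by positivity) (by have := ht₀pos.trans htT; positivity),
      Real.log_mul (by norm_num) (Real.exp_pos _).ne', Real.log_exp,
      Real.log_div (ht₀pos.trans htT).ne' ht₀pos.ne',
      show (16 : ℝ) = 2 ^ 4 by norm_num, Real.log_pow]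
    push_cast
    linarith
  have hratio : T / t₀ = 1 + ρ ^ 2 * (D * s ^ 2) / (q * n ^ 2) := by
    rw [hT, add_div, div_self ht₀pos.ne', ht₀]
    congr 1
    field_simp
  rw [hratio] at hlower
  set Q := 16 * Real.exp 1 * (1 + ρ ^ 2 * (D * s ^ 2) / (q * n ^ 2)) with hQ
  have hQpos : 0 < Q := by positivity
  have hmass := hflow.sum_exp_le hgrad (m := G.componentMeasure m x)
    (componentMeasure_nonneg hm x) (componentMeasure_symm hm x) (ht₀pos.trans htT).le
  have hM : ∑ y, G.componentMeasure m x y * Real.exp (3 / 2 * u 0 y)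
      = ∑ y, G.componentMeasure m x y * Real.exp (-(3 / 2 * s * G.toSimpleGraph.dist x y)) := by
    refine Finset.sum_congr rfl fun y _ => ?_
    rw [hu0]
    congr 2
    ring
  rw [hM] at hmass
  refine le_trans ?_ (mul_le_mul_of_nonneg_left hmass (by positivity))
  rw [Finset.mul_sum, vertexVolume_ball_eq]
  refine Finset.sum_le_sum fun y _ => ?_
  have hnn := componentMeasure_nonneg hm x y
  split_ifs with hd
  · by_cases hr : G.toSimpleGraph.Reachable x y
    · have h1 := hlower y ⟨hr, hd⟩
      have h2 : 1 ≤ Q ^ (3 / 4 * n) * Real.exp (3 / 2 * u T y) := by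
        rw [Real.rpow_def_of_pos hQpos, ← Real.exp_add]
        refine Real.one_le_exp ?_
        linarith
      nlinarith
    · have : G.componentMeasure m x y = 0 := Set.indicator_of_notMem (s := {y | G.toSimpleGraph.Reachable x y}) hr m
      simp [this]
  · positivity

/-- If `D < 2 q_min`, every connected component has at most two vertices. -/
lemma adj_of_reachable_of_maxDegree_lt (hm : G.IsReversibleMeasure m)
    (hD : G.maxDegree < 2 * G.qmin) {x y : V} (h : G.toSimpleGraph.Reachable x y) :
    y = x ∨ G.toSimpleGraph.Adj x y := by
  classical
  have huniq : ∀ a b c, G.toSimpleGraph.Adj a b → G.toSimpleGraph.Adj a c → b = c := by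
    intro a b c hb hc
    by_contra hne
    have hb' := hm.adj_iff.1 hb
    have hc' := hm.adj_iff.1 hc
    have h1 := Finset.sum_le_sum_of_subset_of_nonneg (f := fun y => G.q a y)
      (Finset.subset_univ {b, c}) (fun i _ _ => G.q_nonneg a i)
    rw [Finset.sum_pair hne] at h1
    linarith [G.sum_q_le_maxDegree a, G.qmin_le hb', G.qmin_le hc']
  obtain ⟨p⟩ := h
  induction p with
  | nil => exact Or.inl rfl
  | @cons a b c hab p ih =>
    rcases ih with rfl | hbc
    · exact Or.inr hab
    · exact Or.inl (huniq b c a hbc hab.symm)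

lemma ball_eq_of_maxDegree_lt (hm : G.IsReversibleMeasure m)
    (hD : G.maxDegree < 2 * G.qmin) (x : V) {r : ℝ} (hr : 1 ≤ r) :
    G.ball x r = {y | G.toSimpleGraph.Reachable x y} := by
  ext y
  refine ⟨fun h => h.1, fun h => ⟨h, ?_⟩⟩
  rcases adj_of_reachable_of_maxDegree_lt hm hD h with rfl | h
  · simp; linarith
  · rw [SimpleGraph.dist_eq_one_iff_adj.2 h]; simpa using hr

end RateGraph

/-! ### Choice of the slope and absorption of the tail -/

lemma exp_four_and_half_gt : (90 : ℝ) ≤ Real.exp (9 / 2) := by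
  have h1 := Real.exp_one_gt_d9
  have h2 : Real.exp (9 / 2) ^ 2 = Real.exp 1 ^ 9 := by
    rw [← Real.exp_nat_mul, ← Real.exp_nat_mul]; norm_num
  have h3 : (2.7182818283 : ℝ) ^ 9 ≤ Real.exp 1 ^ 9 := pow_le_pow_left₀ (by norm_num) h1.le 9
  refine le_of_sq_le_sq ?_ (Real.exp_pos _).le
  rw [h2]
  refine le_trans ?_ h3
  norm_num

lemma mul_exp_neg_sqrt_le {μ : ℝ} (hμ : 2 ≤ μ) :
    107 / 5 * μ * Real.exp (-(16 / 5 * √μ)) ≤ 1 / 2 := by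
  set w := √μ with hw
  have hw2 : w ^ 2 = μ := Real.sq_sqrt (by linarith)
  have hw1 : 1414 / 1000 ≤ w := Real.le_sqrt_of_sq_le (by norm_num; linarith)
  have h1 := Real.quadratic_le_exp_of_nonneg (x := 16 / 5 * w - 9 / 2) (by linarith)
  have h2 : Real.exp (16 / 5 * w) = Real.exp (9 / 2) * Real.exp (16 / 5 * w - 9 / 2) := by
    rw [← Real.exp_add]; ring_nf
  have h3 : 214 / 5 * μ ≤ Real.exp (16 / 5 * w) := by
    rw [h2, ← hw2]
    have h4 := mul_le_mul exp_four_and_half_gt h1 (by nlinarith) (Real.exp_pos _).le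
    nlinarith
  rw [Real.exp_neg, ← div_eq_mul_inv, div_le_iff₀ (Real.exp_pos _)]
  linarith

namespace RateGraph

variable {V : Type*} [Fintype V] {G : RateGraph V} {m : V → ℝ}

/-- Polynomial bound on the volume of balls of radius `ρ ≥ r` in terms of the
volume weighted by `exp (-(3/2) s d)`, where the slope `s` is proportional to `1 / r`. -/
lemma vertexVolume_ball_le_rpow (hedge : ∃ x y, 0 < G.q x y) (hm : G.IsReversibleMeasure m)
    {n : ℝ} (hn : 1 ≤ n) (hCD : G.CD 0 n) {μ : ℝ} (hμ : μ = G.maxDegree / G.qmin) (hμ2 : 2 ≤ μ)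
    {r : ℝ} (hr : 4 * n ^ 2 * μ ≤ r) (x : V) {ρ : ℝ} (hρ : r ≤ ρ) :
    vertexVolume m (G.ball x ρ) ≤ (107 / 5 * μ * (ρ / r)) ^ (3 / 2 * n)
        * ∑ y, G.componentMeasure m x y *
          Real.exp (-(3 / 2 * (16 / 5 * n * √μ / r) * G.toSimpleGraph.dist x y)) := by
  have hq := G.qmin_pos hedge
  have hμ0 : 0 < μ := by linarith
  have hr0 : 0 < r := lt_of_lt_of_le (by positivity) hr
  have hD : G.maxDegree = μ * G.qmin := by rw [hμ]; field_simp
  have hsq : √μ ^ 2 = μ := Real.sq_sqrt hμ0.le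
  set θ := ρ / r with hθ
  have hθ1 : 1 ≤ θ := (one_le_div hr0).2 hρ
  have hDs : G.maxDegree * (16 / 5 * n * √μ / r) ^ 2 = G.qmin * (16 / 5 * (n * μ / r)) ^ 2 := by
    rw [hD, div_pow, mul_pow, hsq]
    ring
  -- Here the lower bound on `r` and `n ≥ 1` enter: `(16/5)(1/4) = 4/5` is the admissible gradient.
  have hb : n * μ / r ≤ 1 / 4 := by
    rw [div_le_iff₀ hr0]
    nlinarith [mul_le_mul_of_nonneg_right hn (mul_nonneg (by linarith : (0 : ℝ) ≤ n) hμ0.le)]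
  have hb0 : 0 ≤ n * μ / r := by positivity
  have h1 := vertexVolume_ball_le hedge hm (by linarith) hCD
    (s := 16 / 5 * n * √μ / r) (by positivity)
    (by rw [hDs]; nlinarith [mul_le_mul hb hb hb0 (by norm_num)]) x (hr0.trans_le hρ)
  refine h1.trans (mul_le_mul_of_nonneg_right ?_ (Finset.sum_nonneg fun y _ =>
    mul_nonneg (componentMeasure_nonneg hm x y) (Real.exp_pos _).le))
  have e : 1 + ρ ^ 2 * (G.maxDegree * (16 / 5 * n * √μ / r) ^ 2) / (G.qmin * n ^ 2)
      = 1 + (16 / 5 * (μ * θ)) ^ 2 := by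
    rw [hDs, hθ]
    field_simp
  rw [e]
  have hμθ : 2 ≤ μ * θ := by nlinarith
  -- `16e (16/5)² < 446` while `(107/5)² > 457`; since `μθ ≥ 2`, the surplus covers the constant
  -- `16e`.
  have hsqle : 16 * Real.exp 1 * (1 + (16 / 5 * (μ * θ)) ^ 2) ≤ (107 / 5 * μ * θ) ^ 2 := by
    have h2 := Real.exp_one_lt_d9
    have h3 : 16 * Real.exp 1 ≤ 43.4926 := by linarith
    have h4 := mul_le_mul_of_nonneg_right h3
      (by positivity : 0 ≤ 1 + (16 / 5 * (μ * θ)) ^ 2)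
    nlinarith
  calc (16 * Real.exp 1 * (1 + (16 / 5 * (μ * θ)) ^ 2)) ^ (3 / 4 * n)
      ≤ ((107 / 5 * μ * θ) ^ 2) ^ (3 / 4 * n) :=
        Real.rpow_le_rpow (by positivity) hsqle (by linarith)
    _ = (107 / 5 * μ * θ) ^ (3 / 2 * n) := by
        rw [← Real.rpow_natCast, ← Real.rpow_mul (by positivity)]
        congr 1
        push_cast
        ring

/-- The exponentially weighted volume is at most twice the volume of the ball of radius `r`. -/
lemma sum_exp_le_two_mul_vertexVolume (hedge : ∃ x y, 0 < G.q x y)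
    (hm : G.IsReversibleMeasure m)
    {n : ℝ} (hn : 1 ≤ n) (hCD : G.CD 0 n) {μ : ℝ} (hμ : μ = G.maxDegree / G.qmin) (hμ2 : 2 ≤ μ)
    {r : ℝ} (hr : 4 * n ^ 2 * μ ≤ r) (x : V) :
    ∑ y, G.componentMeasure m x y *
        Real.exp (-(3 / 2 * (16 / 5 * n * √μ / r) * G.toSimpleGraph.dist x y))
      ≤ 2 * vertexVolume m (G.ball x r) := by
  have hμ0 : 0 < μ := by linarith
  have hr0 : 0 < r := lt_of_lt_of_le (by positivity) hr
  have hball := fun ρ (hρ : r ≤ ρ) => vertexVolume_ball_le_rpow hedge hm hn hCD hμ hμ2 hr x hρ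
  set M := ∑ y, G.componentMeasure m x y *
    Real.exp (-(3 / 2 * (16 / 5 * n * √μ / r) * G.toSimpleGraph.dist x y)) with hM
  have hM0 : 0 ≤ M := Finset.sum_nonneg fun y _ =>
    mul_nonneg (componentMeasure_nonneg hm x y) (Real.exp_pos _).le
  set P := 3 / 2 * n with hP
  set κ := 16 / 5 * √μ with hκ
  have hκ4 : 4 ≤ κ := by
    have : 5 / 4 ≤ √μ := Real.le_sqrt_of_sq_le (by norm_num; linarith)
    linarith
  have hP1 : 3 / 2 ≤ P := by linarith
  -- Since `(1/2)^P ≤ 3/8`, the error `(4/3)E` is at most `M/2` and is absorbed on the left.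
  have h1 := sum_exp_neg_le_of_layers (componentMeasure_nonneg hm x)
    (fun y => G.toSimpleGraph.dist x y) (a := 3 / 2 * (16 / 5 * n * √μ / r)) (r := r)
    (E := (1 / 2 : ℝ) ^ P * M) (by positivity) hr0.le (by positivity) ?_
  · rw [← hM, ← vertexVolume_ball_eq] at h1
    have h2 : (1 / 2 : ℝ) ^ P ≤ 3 / 8 := by
      refine (Real.rpow_le_rpow_of_exponent_ge (by norm_num) (by norm_num) hP1).trans ?_
      have h3 : ((1 / 2 : ℝ) ^ (3 / 2 : ℝ)) ^ 2 = 1 / 8 := by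
        rw [← Real.rpow_natCast, ← Real.rpow_mul (by norm_num)]
        norm_num
      refine le_of_sq_le_sq ?_ (by norm_num)
      rw [h3]; norm_num
    have h4 := mul_le_mul_of_nonneg_right h2 hM0
    linarith
  · intro k hk
    rw [← vertexVolume_ball_eq]
    set θ := (k : ℝ) / r with hθ
    have hθ1 : 1 ≤ θ := (one_le_div hr0).2 hk.le
    have hkθ : (k : ℝ) = θ * r := by rw [hθ]; field_simp
    have e1 : 3 / 2 * (16 / 5 * n * √μ / r) * k = P * (κ * θ) := by
      rw [hkθ, hP, hκ]; field_simp
    have e2 : 3 / 4 * (3 / 2 * (16 / 5 * n * √μ / r)) * (k - r) = P * (3 / 4 * κ * (θ - 1)) := by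
      rw [hkθ, hP, hκ]; field_simp
    have hexp : ∀ z, Real.exp (-(P * z)) = Real.exp (-z) ^ P := fun z => by
      rw [← Real.exp_mul]; ring_nf
    rw [e1, e2, hexp, hexp]
    -- As `κ ≥ 4`, a quarter of the decay in `θ - 1` pays for the factor `θ ≤ exp(θ - 1)`.
    have hbase : Real.exp (-(κ * θ)) * (107 / 5 * μ * θ)
        ≤ 1 / 2 * Real.exp (-(3 / 4 * κ * (θ - 1))) := by
      have h2 : θ ≤ Real.exp (θ - 1) := by linarith [Real.add_one_le_exp (θ - 1)]
      calc Real.exp (-(κ * θ)) * (107 / 5 * μ * θ)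
          = (107 / 5 * μ * Real.exp (-κ)) * (Real.exp (-(κ * (θ - 1))) * θ) := by
            rw [show -(κ * θ) = -κ + -(κ * (θ - 1)) by ring, Real.exp_add]
            ring
        _ ≤ 1 / 2 * Real.exp (-(3 / 4 * κ * (θ - 1))) := by
            refine mul_le_mul (mul_exp_neg_sqrt_le hμ2) ?_ (by positivity) (by norm_num)
            refine (mul_le_mul_of_nonneg_left h2 (Real.exp_pos _).le).trans ?_
            rw [← Real.exp_add, Real.exp_le_exp]
            nlinarith
    calc Real.exp (-(κ * θ)) ^ P * vertexVolume m (G.ball x k)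
        ≤ Real.exp (-(κ * θ)) ^ P * ((107 / 5 * μ * θ) ^ P * M) :=
          mul_le_mul_of_nonneg_left (hball k hk.le) (by positivity)
      _ = (Real.exp (-(κ * θ)) * (107 / 5 * μ * θ)) ^ P * M := by
          rw [← mul_assoc, ← Real.mul_rpow (by positivity) (by positivity)]
      _ ≤ (1 / 2 * Real.exp (-(3 / 4 * κ * (θ - 1)))) ^ P * M :=
          mul_le_mul_of_nonneg_right
            (Real.rpow_le_rpow (by positivity) hbase (by linarith)) hM0
      _ = (1 / 2 : ℝ) ^ P * M * Real.exp (-(3 / 4 * κ * (θ - 1))) ^ P := by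
          rw [Real.mul_rpow (by norm_num) (by positivity)]; ring

end RateGraph

theorem mainTheorem2 {V : Type*} [Fintype V] (G : RateGraph V)
    (hedge : ∃ x y, 0 < G.q x y)
    (m : V → ℝ) (hm : G.IsReversibleMeasure m)
    (n : ℝ) (hn : 0 < n) (hCD : G.CD 0 n)
    (r : ℝ) (hr : 4 * n ^ 2 * G.maxDegree / G.qmin ≤ r) (x : V) :
    vertexVolume m (G.ball x (2 * r)) / vertexVolume m (G.ball x r)
      ≤ (9 * n * Real.sqrt (G.maxDegree / G.qmin)) ^ (3 * n) := by
  have hn1 : 1 ≤ n := RateGraph.CD.one_le hedge hn hCD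
  have hq := G.qmin_pos hedge
  obtain ⟨μ, hμ⟩ : ∃ μ, μ = G.maxDegree / G.qmin := ⟨_, rfl⟩
  have hμ1 : 1 ≤ μ := hμ ▸ (one_le_div hq).2 (G.qmin_le_maxDegree hedge)
  rw [mul_div_assoc, ← hμ] at hr
  rw [← hμ]
  have hn2 : 1 ≤ n ^ 2 := one_le_pow₀ hn1
  have hnμ : 1 ≤ n ^ 2 * μ := one_le_mul_of_one_le_of_one_le hn2 hμ1
  have hr1 : 1 ≤ r := by linarith
  have hpos := RateGraph.vertexVolume_ball_pos hm x (zero_le_one.trans hr1)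
  rcases lt_or_ge μ 2 with h2 | h2
  · have hD : G.maxDegree < 2 * G.qmin := by rwa [hμ, div_lt_iff₀ hq] at h2
    rw [RateGraph.ball_eq_of_maxDegree_lt hm hD x (by linarith : 1 ≤ 2 * r),
      ← RateGraph.ball_eq_of_maxDegree_lt hm hD x hr1, div_self hpos.ne']
    refine Real.one_le_rpow ?_ (by linarith)
    have : 1 ≤ √μ := Real.one_le_sqrt.2 hμ1
    nlinarith
  · rw [div_le_iff₀ hpos]
    have h3 := RateGraph.vertexVolume_ball_le_rpow hedge hm hn1 hCD hμ h2 hr x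
      (by linarith : r ≤ 2 * r)
    have h4 := RateGraph.sum_exp_le_two_mul_vertexVolume hedge hm hn1 hCD hμ h2 hr x
    rw [mul_div_cancel_right₀ _ (by linarith : r ≠ 0)] at h3
    refine h3.trans ((mul_le_mul_of_nonneg_left h4 (by positivity)).trans ?_)
    rw [← mul_assoc]
    refine mul_le_mul_of_nonneg_right ?_ hpos.le
    -- The factor `2` is moved into the base, where `(107/5) · 2 · (8/5) < 9²`.
    have h5 : (2 : ℝ) ≤ (8 / 5) ^ (3 / 2 * n) := by
      refine le_trans ?_ (Real.rpow_le_rpow_of_exponent_le (by norm_num)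
        (by linarith : (3 / 2 : ℝ) ≤ 3 / 2 * n))
      refine le_of_sq_le_sq ?_ (by positivity)
      rw [← Real.rpow_natCast (_ ^ _), ← Real.rpow_mul (by norm_num)]
      norm_num
    calc (107 / 5 * μ * 2) ^ (3 / 2 * n) * 2
        ≤ (107 / 5 * μ * 2) ^ (3 / 2 * n) * (8 / 5) ^ (3 / 2 * n) :=
          mul_le_mul_of_nonneg_left h5 (by positivity)
      _ = (107 / 5 * μ * 2 * (8 / 5)) ^ (3 / 2 * n) :=
          (Real.mul_rpow (by positivity) (by norm_num)).symm
      _ ≤ ((9 * n * √μ) ^ 2) ^ (3 / 2 * n) := by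
          refine Real.rpow_le_rpow (by positivity) ?_ (by linarith)
          rw [mul_pow, Real.sq_sqrt (by linarith)]
          nlinarith
      _ = (9 * n * √μ) ^ (3 * n) := by
          rw [← Real.rpow_natCast, ← Real.rpow_mul (by positivity)]
          congr 1
          push_cast
          ring
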